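/- **Setting.** Let $X$ be a $\mathrm{CAT}(0)$ space and let $H$ be a group acting freely, properly (every point $x$ has a ball $B$ such that $\{h\in H : hB\cap B\neq\emptyset\}$ is finite) and by isometries on $X$. Let $C\subset X$ be closed, convex and $H$-invariant, with $H$ acting cocompactly on $C$, and let $\epsilon>0$. For $S\subset X$ and $R>0$ put $N_R(S)=\{x : d(x,S)\le R\}$, and put $C_\epsilon=N_\epsilon(C)$. Let $\Sigma_\epsilon$ be an $H$-invariant connected component of the topological boundary $\partial C_\epsilon$, and let $Y_\epsilon$ be a connected component of $X\setminus C_\epsilon$ with $\partial Y_\epsilon\cap\Sigma_\epsilon\ne\emptyset$. For $q\in\Sigma_\epsilon$ and $q'\in X\setminus C_\epsilon$ let $\angle_q(q',C)$ be the Alexandrov angle at $q$ between the geodesics from $q$ to $q'$ and from $q$ to the point of $C$ closest to $q$. Let $K\subset C_\epsilon$ be compact with $HK=C_\epsilon$, let $K_{out}\subset Y_\epsilon$ be compact, $\alpha>\pi/2$, and let $\mathcal U$ be a finite cover of $K$ by open subsets of $X$. Put $H\mathcal U=\{hU : h\in H, U\in\mathcal U\}$ and $\mathcal U_\Sigma=\{U\in\mathcal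 U : U\cap\Sigma_\epsilon\neq\emptyset\}$, and let $N(\cdot)$ denote the nerve. **Smallness.** Let $\delta,\delta'>0$ be such that $(\delta,\delta')$ is small relative to $K,K_{out},\alpha$, that is: 1. if $h\in H$ and $hK\cap K=\emptyset$, then $\inf\{d(p,q) : p\in K, q\in hK\}>2\delta$; 2. $N_{\delta'}(K_{out})\cap C_\epsilon=\emptyset$; 3. for all $q_1,q_2\in N_\delta(K)\cap\Sigma_\epsilon$ and $q_1',q_2'\in N_{\delta'}(K_{out})$ with $d(q_1,q_2)\le\delta$ and $d(q_1',q_2')\le\delta'$ one has $|\angle_{q_1}(q_1',C)-\angle_{q_2}(q_2',C)|\le\frac{\alpha}{2}-\frac{\pi}{4}$. **Grids and tightness.** A $(\mathcal U,\alpha)$-push-off grid is an $H$-equivariant map $\iota:N(H\mathcal U)^{(0)}\to Y_\epsilon$ such that every $U\in\mathcal U_\Sigma$ contains a point $q\in\Sigma_\epsilon$ with $\angle_q(\iota(U),C)\ge\alpha$; it is part of the definition that $\mathcal U$ is $H$-fine, i.e. $U\cap hU=\emptyset$ for all $U\in\mathcal U$ and $1\ne h\in H$. For a simplicial complex $S$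 and a map $\iota:S^{(0)}\to X$ let $\operatorname{diam}(\iota)$ be the supremum of $\operatorname{diam}\iota(\sigma^{(0)})$ over the simplices $\sigma$ of $S$. If $S$ is $N(H\mathcal U)$ or a subdivision of it, then $\iota$ is $(\delta,\delta')$-tight if $\operatorname{diam}(U)\le\delta$ for all $U\in H\mathcal U$ and $\operatorname{diam}(\iota)\le\delta'$, and its push-off distance $d_{push-off}(\iota)$ is $\inf\{d(\iota(v),C_\epsilon) : v\in S^{(0)}\}$. A map $\iota$ on $N(H\mathcal U)^{(0)}$ is $(\delta,\delta')$-tight on the boundary if $\operatorname{diam}(U)\le\delta$ for all $U\in H\mathcal U$ and $\operatorname{diam}(\iota|_{N(H\mathcal U_\Sigma)^{(0)}})\le\delta'$. **Shrinking subdivisions.** Let $\lambda\in[\frac12,1)$. A $\lambda$-shrinking subdivision of $(S,\iota)$ is a pair $(S',\iota')$, where $S'$ is a subdivision of $S$ that divides every simplex of $S$ into finitely many simplices and $\iota':S'^{(0)}\to X$ extends $\iota$, such that (a) $\operatorname{diam}\iota'(\sigma'^{(0)})\le\lambda\operatorname{diam}\iota(\sigma^{(0)})$ whenever $\sigma'$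 is a simplex of $S'$ and $\sigma$ is the least-dimensional simplex of $S$ containing $\sigma'$, and (b) $\operatorname{diam}\iota'(\sigma\cap S'^{(0)})\le\operatorname{diam}\iota(\sigma^{(0)})$ for every closed simplex $\sigma$ of $S$. Such a pair is a $\lambda$-shrinking subdivision of order $1$; one of order $n+1$ is a $\lambda$-shrinking subdivision of one of order $n$. **Theorem.** In this setting: (i) If there exists a $(\delta,\delta')$-tight $(\mathcal U,\alpha)$-push-off grid $\iota$ with $\iota(\mathcal U)\subset K_{out}$, then $\Sigma_\epsilon$ is contractible. (ii) If, for some $\lambda\in[\frac12,1)$ and $n\ge1$, there exists a $(\mathcal U,\alpha)$-push-off grid $\iota$ that is $(\delta,(1-\lambda)\delta')$-tight on the boundary, satisfies $\iota(\mathcal U)\subset K_{out}$, and admits a $\lambda$-shrinking subdivision $(S_n,\iota_n)$ of $(N(H\mathcal U),\iota)$ of order $n$ such that $\iota_n$ is $(\delta,\delta')$-tight and $\delta'<d_{push-off}(\iota_n)$, then $\Sigma_\epsilon$ is contractible. -/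

import Mathlib

open Set Filter Topology
open scoped Pointwise ENNReal

noncomputable section

namespace PushOff

/-! ### Geodesics, CAT(0) spaces, convex sets, angles -/

section Geometry

variable {X : Type*} [MetricSpace X]

/-- `γ`, restricted to `[0, d(x,y)]`, is a unit speed geodesic from `x` to `y`. -/
def IsGeodesic (γ : ℝ → X) (x y : X) : Prop :=
  γ 0 = x ∧ γ (dist x y) = y ∧
    ∀ s ∈ Icc (0 : ℝ) (dist x y), ∀ t ∈ Icc (0 : ℝ) (dist x y), dist (γ s) (γ t) = |s - t|

/-- A CAT(0) space: a geodesic space in which every geodesic triangle is at least as thin as its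
comparison triangle `p' q' r'` in the Euclidean plane. (Any two points on different sides lie on
two sides with a common vertex, here called `p`.) -/
structure IsCAT0 (X : Type*) [MetricSpace X] : Prop where
  exists_geodesic : ∀ x y : X, ∃ γ : ℝ → X, IsGeodesic γ x y
  comparison : ∀ (p q r : X) (γ γ' : ℝ → X), IsGeodesic γ p q → IsGeodesic γ' p r →
    ∃ p' q' r' : EuclideanSpace ℝ (Fin 2),
      dist p' q' = dist p q ∧ dist p' r' = dist p r ∧ dist q' r' = dist q r ∧
      ∀ s ∈ Icc (0 : ℝ) 1, ∀ t ∈ Icc (0 : ℝ) 1,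
        dist (γ (s * dist p q)) (γ' (t * dist p r)) ≤
          dist (AffineMap.lineMap p' q' s) (AffineMap.lineMap p' r' t)

/-- Geodesic convexity. -/
def IsGeodConvex (C : Set X) : Prop :=
  ∀ x ∈ C, ∀ y ∈ C, ∀ γ : ℝ → X, IsGeodesic γ x y → ∀ t ∈ Icc (0 : ℝ) (dist x y), γ t ∈ C

open Classical in
/-- The geodesic from `x` to `y` (unique on `[0, d(x,y)]` in a CAT(0) space). -/
def geod (x y : X) : ℝ → X :=
  if h : ∃ γ : ℝ → X, IsGeodesic γ x y then h.choose else fun _ => x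

open Classical in
/-- The closest-point projection onto `C`. -/
def proj (C : Set X) (x : X) : X :=
  if h : ∃ p ∈ C, ∀ p' ∈ C, dist x p ≤ dist x p' then h.choose else x

/-- The Euclidean comparison angle at `o` of the triple `o, x, y` (for `x ≠ o ≠ y`). -/
def comparisonAngle (o x y : X) : ℝ :=
  Real.arccos ((dist o x ^ 2 + dist o y ^ 2 - dist x y ^ 2) / (2 * dist o x * dist o y))

/-- The (Alexandrov) angle at `o` between the geodesics from `o` to `p` and from `o` to `q`
(for `p ≠ o ≠ q`). -/
def angle (o p q : X) : ℝ :=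
  limsup (fun t : ℝ × ℝ => comparisonAngle o (geod o p t.1) (geod o q t.2))
    (𝓝[>] (0 : ℝ) ×ˢ 𝓝[>] (0 : ℝ))

/-- `∠_q(q', C)`, the angle at `q` between `q'` and the projection of `q` to `C`. -/
def angleTo (C : Set X) (q q' : X) : ℝ := angle q q' (proj C q)

end Geometry

/-- `A` is a connected component of the set `F`. -/
def IsComponentOf {X : Type*} [TopologicalSpace X] (A F : Set X) : Prop :=
  ∃ x ∈ F, A = connectedComponentIn F x

/-! ### Group actions and families of sets -/

section Action

variable (H : Type*) {X : Type*} [Group H] [MulAction H X]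

/-- A proper action on a metric space: every point has a ball that meets only finitely many of its
translates. -/
def IsProperAction (X : Type*) [MetricSpace X] [MulAction H X] : Prop :=
  ∀ x : X, ∃ r > 0, {h : H | (h • Metric.ball x r ∩ Metric.ball x r).Nonempty}.Finite

/-- The orbit `HK` of a set `K`. -/
def orbitSet (K : Set X) : Set X := ⋃ h : H, h • K

/-- The family `H𝒰` of all translates of members of `𝒰`. -/
def orbitFamily (𝒰 : Set (Set X)) : Set (Set X) := {V | ∃ h : H, ∃ U ∈ 𝒰, V = h • U}

/-- `𝒰` is `H`-fine: no member meets one of its nontrivial translates. -/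
def IsHFine (𝒰 : Set (Set X)) : Prop := ∀ U ∈ 𝒰, ∀ h : H, h ≠ 1 → U ∩ h • U = ∅

/-- The members of `𝒰` that meet `B`. -/
def membersMeeting (𝒰 : Set (Set X)) (B : Set X) : Set (Set X) := {U ∈ 𝒰 | (U ∩ B).Nonempty}

end Action

/-! ### The nerve of a family of sets -/

section Nerve

variable {X : Type*}

/-- The nerve as an abstract complex: finitely many members of `𝒱` span a simplex iff they have a
common point. -/
def abstractNerve (𝒱 : Set (Set X)) : PreAbstractSimplicialComplex (Set X) where
  faces := {s | s.Nonempty ∧ (∀ U ∈ s, U ∈ 𝒱) ∧ ∃ x, ∀ U ∈ s, x ∈ U}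
  isRelLowerSet_faces := by
    rintro s ⟨hs, h𝒱, x, hx⟩
    exact ⟨hs, fun t hts ht =>
      ⟨ht, fun U hU => h𝒱 U (hts hU), x, fun U hU => hx U (hts hU)⟩⟩

open Classical in
/-- The nerve `N(𝒱)`, realized in the vector space with one basis vector for each set. -/
def nerve (𝒱 : Set (Set X)) : Geometry.SimplicialComplex ℝ (Set X →₀ ℝ) :=
  Geometry.SimplicialComplex.onFinsupp (abstractNerve 𝒱)

/-- The vertex of the nerve that belongs to the set `U`. -/
def vtx (U : Set X) : Set X →₀ ℝ := Finsupp.single U 1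

end Nerve

/-! ### Maps on the vertices of a simplicial complex, and subdivisions

A map `S⁽⁰⁾ → X` is given by a function on the ambient vector space, of which only the values at
the vertices are used. -/

section Complexes

variable {E X : Type*} [AddCommGroup E] [Module ℝ E] [MetricSpace X]

/-- `diam(ι)`, the supremum of the diameters of the images of the vertex sets of simplices. -/
def mapDiam (S : Geometry.SimplicialComplex ℝ E) (ι : E → X) : ℝ≥0∞ :=
  ⨆ s ∈ S.faces, Metric.ediam (ι '' (s : Set E))

/-- The push-off distance of `ι`: the infimum of the distances from images of vertices to `D`. -/
def pushOffDist (D : Set X) (S : Geometry.SimplicialComplex ℝ E) (ι : E → X) : ℝ≥0∞ :=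
  ⨅ v ∈ S.vertices, Metric.infEDist (ι v) D

/-- `S'` is a subdivision of `S` in which every simplex of `S` is subdivided into finitely many
simplices. -/
structure IsLocallyFiniteSubdivision (S S' : Geometry.SimplicialComplex ℝ E) : Prop where
  space_eq : S'.space = S.space
  subset_simplex : ∀ s' ∈ S'.faces, ∃ s ∈ S.faces,
    convexHull ℝ (s' : Set E) ⊆ convexHull ℝ (s : Set E)
  finite : ∀ s ∈ S.faces,
    {s' ∈ S'.faces | convexHull ℝ (s' : Set E) ⊆ convexHull ℝ (s : Set E)}.Finite

/-- `s` is the least-dimensional simplex of `S` that contains the simplex spanned by `s'`. -/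
def IsCarrier (S : Geometry.SimplicialComplex ℝ E) (s' s : Finset E) : Prop :=
  s ∈ S.faces ∧ convexHull ℝ (s' : Set E) ⊆ convexHull ℝ (s : Set E) ∧
    ∀ t ∈ S.faces, convexHull ℝ (s' : Set E) ⊆ convexHull ℝ (t : Set E) → s.card ≤ t.card

/-- `(S', ι')` is a `lam`-shrinking subdivision of `(S, ι)`. -/
structure IsShrinkingSubdivision (lam : ℝ)
    (S : Geometry.SimplicialComplex ℝ E) (ι : E → X)
    (S' : Geometry.SimplicialComplex ℝ E) (ι' : E → X) : Prop where
  subdivision : IsLocallyFiniteSubdivision S S'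
  extends_map : ∀ v ∈ S.vertices, ι' v = ι v
  shrinking : ∀ s' ∈ S'.faces, ∀ s, IsCarrier S s' s →
    Metric.ediam (ι' '' (s' : Set E)) ≤ ENNReal.ofReal lam * Metric.ediam (ι '' (s : Set E))
  diam_le : ∀ s ∈ S.faces,
    Metric.ediam (ι' '' (S'.vertices ∩ convexHull ℝ (s : Set E))) ≤
      Metric.ediam (ι '' (s : Set E))

/-- `(S', ι')` is a `lam`-shrinking subdivision of `(S, ι)` of order `n` (where `n ≥ 1`). -/
inductive IsShrinkingSubdivisionOfOrder (lam : ℝ)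
    (S : Geometry.SimplicialComplex ℝ E) (ι : E → X) :
    ℕ → Geometry.SimplicialComplex ℝ E → (E → X) → Prop
  | one {S' : Geometry.SimplicialComplex ℝ E} {ι' : E → X} :
      IsShrinkingSubdivision lam S ι S' ι' → IsShrinkingSubdivisionOfOrder lam S ι 1 S' ι'
  | succ {n : ℕ} {S' S'' : Geometry.SimplicialComplex ℝ E} {ι' ι'' : E → X} :
      IsShrinkingSubdivisionOfOrder lam S ι n S' ι' →
      IsShrinkingSubdivision lam S' ι' S'' ι'' →
      IsShrinkingSubdivisionOfOrder lam S ι (n + 1) S'' ι''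

end Complexes

/-! ### Push-off grids, tightness and smallness -/

section Grids

variable (H : Type*) {X : Type*} [Group H] [MetricSpace X] [MulAction H X]

/-- `ι` is a `(𝒰, α)`-push-off grid: an `H`-equivariant map from the vertices of `N(H𝒰)` to `Y`
such that every member `U` of `𝒰` that meets `B` contains a point `q` of `B` with
`∠_q(ι(U), C) ≥ α`. (The sets `C`, `B`, `Y` stand for `C`, `Σ_ε`, `Y_ε`.) -/
structure IsPushOffGrid (C B Y : Set X) (𝒰 : Set (Set X)) (α : ℝ)
    (ι : (Set X →₀ ℝ) → X) : Prop where
  fine : IsHFine H 𝒰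
  maps_to : ∀ V ∈ orbitFamily H 𝒰, ι (vtx V) ∈ Y
  equivariant : ∀ h : H, ∀ V ∈ orbitFamily H 𝒰, ι (vtx (h • V)) = h • ι (vtx V)
  angle_ge : ∀ U ∈ membersMeeting 𝒰 B, ∃ q ∈ U ∩ B, α ≤ angleTo C q (ι (vtx U))

/-- `(δ, δ')`-tightness of a map `ι` on the vertices of `S`, where `S` is the nerve `N(H𝒰)` or a
subdivision of it. -/
def IsTight {E : Type*} [AddCommGroup E] [Module ℝ E] (𝒰 : Set (Set X)) (δ δ' : ℝ)
    (S : Geometry.SimplicialComplex ℝ E) (ι : E → X) : Prop :=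
  (∀ V ∈ orbitFamily H 𝒰, Metric.ediam V ≤ ENNReal.ofReal δ) ∧
    mapDiam S ι ≤ ENNReal.ofReal δ'

/-- `(δ, δ')`-tightness on the boundary `B`: the condition on `diam(ι)` is imposed only on the
subcomplex `N(H𝒰_B)`, where `𝒰_B` consists of the members of `𝒰` that meet `B`. -/
def IsTightOnBoundary (B : Set X) (𝒰 : Set (Set X)) (δ δ' : ℝ)
    (ι : (Set X →₀ ℝ) → X) : Prop :=
  (∀ V ∈ orbitFamily H 𝒰, Metric.ediam V ≤ ENNReal.ofReal δ) ∧
    mapDiam (nerve (orbitFamily H (membersMeeting 𝒰 B))) ι ≤ ENNReal.ofReal δ'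

/-- `(δ, δ')` is small relative to `K`, `Kout` and `α`. (The sets `C`, `Ce`, `B` stand for `C`,
`C_ε`, `Σ_ε`.) -/
structure IsSmall (C Ce B K Kout : Set X) (α δ δ' : ℝ) : Prop where
  separated : ∀ h : H, h • K ∩ K = ∅ → 2 * δ < sInf {r : ℝ | ∃ p ∈ K, ∃ q ∈ h • K, r = dist p q}
  disjoint : Metric.cthickening δ' Kout ∩ Ce = ∅
  angle_close : ∀ q₁ ∈ Metric.cthickening δ K ∩ B, ∀ q₂ ∈ Metric.cthickening δ K ∩ B,
    ∀ q₁' ∈ Metric.cthickening δ' Kout, ∀ q₂' ∈ Metric.cthickening δ' Kout,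
      dist q₁ q₂ ≤ δ → dist q₁' q₂' ≤ δ' →
        |angleTo C q₁ q₁' - angleTo C q₂ q₂'| ≤ α / 2 - Real.pi / 4

end Grids

end PushOff

end

open PushOff

/-! The identity of Σ_ε is deformed, inside Σ_ε, to a map that factors through the contractible
space C_ε; hence it is nullhomotopic. The factorization comes from a continuous map f : C_ε → X \
C_ε such that, for q in Σ_ε, the geodesic from q to f(q) leaves C_ε at once and never returns.
Following these geodesics and projecting radially back to ∂C_ε (`radial`) moves q to the radial
image of f(q); connectedness keeps everything in the component Σ_ε (`contractibleSpace_of_pushOff`).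

To build f, a partition of unity subordinate to translates of members of 𝒰 sends C_ε to the nerve.
The barycentric coordinates in a subdivision S of the nerve (`IsContinuousWeight.bary`) then weight
the points κ(v) given at the vertices of S, and iterated geodesic combination yields f
(`exists_continuous_of_isContinuousWeight`). Since balls are convex, f(z) is δ'-close to κ(v) for
each vertex v of the simplex carrying z; so it lies outside C_ε. No equivariance of f is needed.

For q in Σ_ε and a set hU around q used by the partition, f(q) is also δ'-close to ι(hU). Smallness
then bounds the angle at q from below by α - (α/2 - π/4) = α/2 + π/4 > π/2, and a geodesic with an
obtuse initial angle moves away from C (`infDist_lt_infDist_seg`).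

In (i), S is the nerve itself. In (ii), S is S_n, and a geometric series bounds how far its vertices
drift from ι on the boundary (`IsShrunk.dist_le`). -/

noncomputable section

namespace PushOff

/-! ### Geodesic segments in CAT(0) spaces -/

section Segments

variable {X : Type*} [MetricSpace X]

theorem IsGeodesic.dist_left {γ : ℝ → X} {x y : X} (h : IsGeodesic γ x y) {s : ℝ}
    (hs : s ∈ Icc (0 : ℝ) (dist x y)) : dist x (γ s) = s := by
  have := h.2.2 0 ⟨le_rfl, dist_nonneg⟩ s hs
  rw [h.1] at this
  rw [this, zero_sub, abs_neg, abs_of_nonneg hs.1]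

theorem IsGeodesic.symm {γ : ℝ → X} {x y : X} (h : IsGeodesic γ x y) :
    IsGeodesic (fun t => γ (dist x y - t)) y x := by
  refine ⟨by simpa using h.2.1, by simpa [dist_comm y x] using h.1, fun s hs t ht => ?_⟩
  rw [dist_comm y x] at hs ht
  rw [h.2.2 _ ⟨by linarith [hs.2], by linarith [hs.1]⟩ _ ⟨by linarith [ht.2], by linarith [ht.1]⟩,
    show dist x y - s - (dist x y - t) = -(s - t) by ring, abs_neg]

theorem IsGeodesic.initial {γ : ℝ → X} {x y : X} (h : IsGeodesic γ x y) {s : ℝ}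
    (hs : s ∈ Icc (0 : ℝ) (dist x y)) : IsGeodesic γ x (γ s) := by
  refine ⟨h.1, by rw [h.dist_left hs], fun a ha b hb => ?_⟩
  rw [h.dist_left hs] at ha hb
  exact h.2.2 a ⟨ha.1, ha.2.trans hs.2⟩ b ⟨hb.1, hb.2.trans hs.2⟩

theorem IsGeodesic.smul {H : Type*} [Group H] [MulAction H X] [IsIsometricSMul H X]
    {γ : ℝ → X} {x y : X} (h : IsGeodesic γ x y) (g : H) :
    IsGeodesic (fun t => g • γ t) (g • x) (g • y) := by
  refine ⟨congrArg (g • ·) h.1, by simp only [dist_smul, h.2.1], fun s hs t ht => ?_⟩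
  rw [dist_smul] at hs ht ⊢
  exact h.2.2 s hs t ht

/-- The point dividing the geodesic from `x` to `y` in the ratio `t : 1 - t`. -/
def seg (x y : X) (t : ℝ) : X := geod x y (t * dist x y)

theorem isGeodesic_geod (hX : IsCAT0 X) (x y : X) : IsGeodesic (geod x y) x y := by
  have h := hX.exists_geodesic x y
  rw [geod, dif_pos h]
  exact h.choose_spec

theorem mul_dist_mem_Icc {x y : X} {t : ℝ} (ht : t ∈ Icc (0 : ℝ) 1) :
    t * dist x y ∈ Icc (0 : ℝ) (dist x y) :=
  ⟨mul_nonneg ht.1 dist_nonneg, mul_le_of_le_one_left dist_nonneg ht.2⟩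

theorem IsCAT0.dist_le_mul (hX : IsCAT0 X) {p q r : X} {γ γ' : ℝ → X} (h : IsGeodesic γ p q)
    (h' : IsGeodesic γ' p r) {t : ℝ} (ht : t ∈ Icc (0 : ℝ) 1) :
    dist (γ (t * dist p q)) (γ' (t * dist p r)) ≤ t * dist q r := by
  obtain ⟨p', q', r', h1, h2, h3, h4⟩ := hX.comparison p q r γ γ' h h'
  refine (h4 t ht t ht).trans ?_
  rw [← h3, dist_eq_norm, dist_eq_norm, AffineMap.lineMap_apply_module,
    AffineMap.lineMap_apply_module,
    show (1 - t) • p' + t • q' - ((1 - t) • p' + t • r') = t • (q' - r') by module, norm_smul,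
    Real.norm_of_nonneg ht.1]

theorem IsCAT0.geodesic_unique (hX : IsCAT0 X) {x y : X} {γ γ' : ℝ → X} (h : IsGeodesic γ x y)
    (h' : IsGeodesic γ' x y) {t : ℝ} (ht : t ∈ Icc (0 : ℝ) 1) :
    γ (t * dist x y) = γ' (t * dist x y) := by
  have := hX.dist_le_mul h h' ht
  rw [dist_self, mul_zero] at this
  exact dist_le_zero.1 this

@[simp] theorem seg_zero (hX : IsCAT0 X) (x y : X) : seg x y 0 = x := by
  rw [seg, zero_mul, (isGeodesic_geod hX x y).1]

@[simp] theorem seg_one (hX : IsCAT0 X) (x y : X) : seg x y 1 = y := by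
  rw [seg, one_mul, (isGeodesic_geod hX x y).2.1]

theorem seg_eq (hX : IsCAT0 X) {x y : X} {γ : ℝ → X} (h : IsGeodesic γ x y) {t : ℝ}
    (ht : t ∈ Icc (0 : ℝ) 1) : seg x y t = γ (t * dist x y) :=
  hX.geodesic_unique (isGeodesic_geod hX x y) h ht

theorem seg_symm (hX : IsCAT0 X) (x y : X) {t : ℝ} (ht : t ∈ Icc (0 : ℝ) 1) :
    seg y x (1 - t) = seg x y t := by
  rw [seg_eq hX (isGeodesic_geod hX x y).symm ⟨by linarith [ht.2], by linarith [ht.1]⟩, seg,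
    dist_comm y x]
  ring_nf

theorem smul_seg (hX : IsCAT0 X) {H : Type*} [Group H] [MulAction H X] [IsIsometricSMul H X]
    (h : H) (x y : X) {t : ℝ} (ht : t ∈ Icc (0 : ℝ) 1) :
    h • seg x y t = seg (h • x) (h • y) t := by
  rw [seg_eq hX ((isGeodesic_geod hX x y).smul h) ht, dist_smul, seg]

theorem dist_seg_seg (hX : IsCAT0 X) (x y : X) {s t : ℝ} (hs : s ∈ Icc (0 : ℝ) 1)
    (ht : t ∈ Icc (0 : ℝ) 1) : dist (seg x y s) (seg x y t) = |s - t| * dist x y := by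
  rw [seg, seg, (isGeodesic_geod hX x y).2.2 _ (mul_dist_mem_Icc hs) _ (mul_dist_mem_Icc ht),
    ← sub_mul, abs_mul, abs_of_nonneg (dist_nonneg (x := x))]

theorem dist_left_seg (hX : IsCAT0 X) (x y : X) {t : ℝ} (ht : t ∈ Icc (0 : ℝ) 1) :
    dist x (seg x y t) = t * dist x y :=
  (isGeodesic_geod hX x y).dist_left (mul_dist_mem_Icc ht)

theorem dist_seg_right (hX : IsCAT0 X) (x y : X) {t : ℝ} (ht : t ∈ Icc (0 : ℝ) 1) :
    dist (seg x y t) y = (1 - t) * dist x y := by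
  have := dist_seg_seg hX x y ht ⟨zero_le_one, le_rfl⟩
  rwa [seg_one hX, abs_sub_comm, abs_of_nonneg (by linarith [ht.2])] at this

theorem seg_seg (hX : IsCAT0 X) (x y : X) {s t : ℝ} (hs : s ∈ Icc (0 : ℝ) 1)
    (ht : t ∈ Icc (0 : ℝ) 1) : seg x (seg x y s) t = seg x y (t * s) := by
  have h := (isGeodesic_geod hX x y).initial (mul_dist_mem_Icc hs)
  rw [seg_eq hX (y := seg x y s) h ht, dist_left_seg hX x y hs, seg, mul_assoc]

theorem IsGeodConvex.seg_mem (hX : IsCAT0 X) {C : Set X} (hC : IsGeodConvex C) {x y : X}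
    (hx : x ∈ C) (hy : y ∈ C) {t : ℝ} (ht : t ∈ Icc (0 : ℝ) 1) : seg x y t ∈ C :=
  hC x hx y hy _ (isGeodesic_geod hX x y) _ (mul_dist_mem_Icc ht)

/-- The Bruhat–Tits inequality. -/
theorem dist_sq_seg_le (hX : IsCAT0 X) (z x y : X) {t : ℝ} (ht : t ∈ Icc (0 : ℝ) 1) :
    dist z (seg x y t) ^ 2 ≤
      (1 - t) * dist z x ^ 2 + t * dist z y ^ 2 - t * (1 - t) * dist x y ^ 2 := by
  obtain ⟨p, q, r, h1, h2, h3, h4⟩ :=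
    hX.comparison x y z _ _ (isGeodesic_geod hX x y) (isGeodesic_geod hX x z)
  have h := h4 t ht 1 ⟨zero_le_one, le_rfl⟩
  rw [one_mul, (isGeodesic_geod hX x z).2.1, AffineMap.lineMap_apply_one] at h
  rw [dist_comm z, dist_comm z x, dist_comm z y, ← h1, ← h2, ← h3]
  refine (pow_le_pow_left₀ dist_nonneg h 2).trans (le_of_eq ?_)
  have hpq : ‖p - q‖ ^ 2 = ‖p - r‖ ^ 2 - 2 * inner ℝ (p - r) (q - r) + ‖q - r‖ ^ 2 := by
    rw [← norm_sub_sq_real, sub_sub_sub_cancel_right]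
  rw [dist_eq_norm, dist_eq_norm, dist_eq_norm, dist_eq_norm, AffineMap.lineMap_apply_module,
    show (1 - t) • p + t • q - r = (1 - t) • (p - r) + t • (q - r) by module, hpq,
    norm_add_sq_real, norm_smul, norm_smul, real_inner_smul_left, real_inner_smul_right,
    mul_pow, mul_pow, Real.norm_eq_abs, Real.norm_eq_abs, sq_abs, sq_abs]
  ring

/-- The Bruhat–Tits inequality without its negative term. This convexity of balls is what controls
all later geodesic combinations. -/
theorem dist_seg_le (hX : IsCAT0 X) (z x y : X) {r t : ℝ} (ht : t ∈ Icc (0 : ℝ) 1)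
    (hx : dist z x ≤ r) (hy : dist z y ≤ r) : dist z (seg x y t) ≤ r := by
  have hr : 0 ≤ r := dist_nonneg.trans hx
  refine abs_le_of_sq_le_sq' ?_ hr |>.2
  have h1 := pow_le_pow_left₀ dist_nonneg hx 2
  have h2 := pow_le_pow_left₀ dist_nonneg hy 2
  have h3 : 0 ≤ t * (1 - t) * dist x y ^ 2 :=
    mul_nonneg (mul_nonneg ht.1 (by linarith [ht.2])) (sq_nonneg _)
  nlinarith [dist_sq_seg_le hX z x y ht, mul_le_mul_of_nonneg_left h2 ht.1,
    mul_le_mul_of_nonneg_left h1 (sub_nonneg.2 ht.2)]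

/-- The diagonal from x to y' shares an endpoint with each of the two geodesics, so comparison
applies twice. -/
theorem dist_seg_seg_le (hX : IsCAT0 X) (x y x' y' : X) {t : ℝ} (ht : t ∈ Icc (0 : ℝ) 1) :
    dist (seg x y t) (seg x' y' t) ≤ (1 - t) * dist x x' + t * dist y y' := by
  have ht' : 1 - t ∈ Icc (0 : ℝ) 1 := ⟨by linarith [ht.2], by linarith [ht.1]⟩
  have h1 : dist (seg x y t) (seg x y' t) ≤ t * dist y y' :=
    hX.dist_le_mul (isGeodesic_geod hX x y) (isGeodesic_geod hX x y') ht
  have h2 : dist (seg y' x (1 - t)) (seg y' x' (1 - t)) ≤ (1 - t) * dist x x' :=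
    hX.dist_le_mul (isGeodesic_geod hX y' x) (isGeodesic_geod hX y' x') ht'
  rw [seg_symm hX x y' ht, seg_symm hX x' y' ht] at h2
  linarith [dist_triangle (seg x y t) (seg x y' t) (seg x' y' t)]

theorem ContinuousAt.seg (hX : IsCAT0 X) {Z : Type*} [TopologicalSpace Z] {f g : Z → X}
    {t : Z → ℝ} {z : Z} (hf : ContinuousAt f z) (hg : ContinuousAt g z) (ht : ContinuousAt t z)
    (ht' : ∀ z, t z ∈ Icc (0 : ℝ) 1) : ContinuousAt (fun z => seg (f z) (g z) (t z)) z := by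
  rw [ContinuousAt, tendsto_iff_dist_tendsto_zero] at hf hg ht ⊢
  have hb : Tendsto (fun w => dist (f w) (f z) + dist (g w) (g z) +
      dist (t w) (t z) * dist (f z) (g z)) (𝓝 z) (𝓝 0) := by
    simpa using (hf.add hg).add (ht.mul_const (dist (f z) (g z)))
  refine squeeze_zero (fun _ => dist_nonneg) (fun w => ?_) hb
  refine (dist_triangle _ (PushOff.seg (f z) (g z) (t w)) _).trans (add_le_add ?_ ?_)
  · refine (dist_seg_seg_le hX _ _ _ _ (ht' w)).trans (add_le_add ?_ ?_)
    · exact mul_le_of_le_one_left dist_nonneg (by linarith [(ht' w).1])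
    · exact mul_le_of_le_one_left dist_nonneg (ht' w).2
  · rw [dist_seg_seg hX _ _ (ht' w) (ht' z), Real.dist_eq]

theorem Continuous.seg (hX : IsCAT0 X) {Z : Type*} [TopologicalSpace Z] {f g : Z → X}
    {t : Z → ℝ} (hf : Continuous f) (hg : Continuous g) (ht : Continuous t)
    (ht' : ∀ z, t z ∈ Icc (0 : ℝ) 1) : Continuous (fun z => seg (f z) (g z) (t z)) :=
  continuous_iff_continuousAt.2 fun _ =>
    ContinuousAt.seg hX hf.continuousAt hg.continuousAt ht.continuousAt ht'

/-- The squares of the diagonals of a quadrilateral add up to at most the sum of the squares of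
its sides. -/
theorem dist_sq_add_dist_sq_le (hX : IsCAT0 X) (x c p q : X) :
    dist x p ^ 2 + dist q c ^ 2 ≤
      dist x c ^ 2 + dist c p ^ 2 + dist p q ^ 2 + dist q x ^ 2 := by
  have ht : (1 / 2 : ℝ) ∈ Icc (0 : ℝ) 1 := by constructor <;> norm_num
  -- Bruhat–Tits from q and from c to the midpoint m of xp, combined with d(q,c)² ≤ 2d(q,m)² +
  -- 2d(c,m)².
  have h1 := dist_sq_seg_le hX q x p ht
  have h2 := dist_sq_seg_le hX c x p ht
  have h3 := dist_triangle_right q c (seg x p (1 / 2))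
  have h4 := pow_le_pow_left₀ dist_nonneg h3 2
  rw [dist_comm q p] at h1
  rw [dist_comm c x] at h2
  nlinarith [sq_nonneg (dist q (seg x p (1 / 2)) - dist c (seg x p (1 / 2)))]

end Segments

/-! ### Closest-point projection and obtuse angles -/

section Projection

variable {X : Type*} [MetricSpace X]

/-- X need not be complete. Write a Cauchy sequence as g_n d_n with d_n → a along a subsequence.
Then the g_n a are eventually close to one another, and properness leaves finitely many values of
g_N⁻¹ g_n: a tail lies in a finite union of translates of D, which is compact. -/
theorem isComplete_orbitSet {H : Type*} [Group H] [MulAction H X] [IsIsometricSMul H X]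
    (hproper : IsProperAction H X) {D : Set X} (hD : IsCompact D) : IsComplete (orbitSet H D) := by
  rw [← completeSpace_coe_iff_isComplete]
  refine Metric.complete_of_cauchySeq_tendsto fun u hu => ?_
  have hu' : ∀ n, ∃ h : H, ∃ d ∈ D, h • d = (u n : X) := fun n => by
    obtain ⟨h, d, hd, e⟩ := mem_iUnion.1 (u n).2
    exact ⟨h, d, hd, e⟩
  choose g d hd hgd using hu'
  obtain ⟨a, -, φ, hφ, hlim⟩ := hD.tendsto_subseq hd
  obtain ⟨r, hr, hfin⟩ := hproper a
  obtain ⟨N₁, hN₁⟩ := Metric.tendsto_atTop.1 hlim (r / 3) (by positivity)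
  obtain ⟨N₂, hN₂⟩ := Metric.cauchySeq_iff.1 hu (r / 3) (by positivity)
  set N := max N₁ N₂
  set S : Set X := ⋃ k ∈ {h : H | (h • Metric.ball a r ∩ Metric.ball a r).Nonempty},
    (fun x => (g (φ N) * k) • x) '' D
  have hS : IsCompact S := hfin.isCompact_biUnion fun k _ =>
    hD.image (isometry_smul X _).continuous
  have hmem : ∀ m, (u (φ (N + m)) : X) ∈ S := fun m => by
    refine mem_biUnion (x := (g (φ N))⁻¹ * g (φ (N + m))) ?_
      ⟨d (φ (N + m)), hd _, by simp [hgd]⟩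
    refine ⟨((g (φ N))⁻¹ * g (φ (N + m))) • a, ⟨a, Metric.mem_ball_self hr, rfl⟩, ?_⟩
    have h1 := hN₁ (N + m) ((le_max_left _ _).trans (Nat.le_add_right _ _))
    have h2 := hN₁ N (le_max_left _ _)
    have h3 := hN₂ (φ (N + m)) (((le_max_right _ _).trans (Nat.le_add_right _ _)).trans
      (hφ.id_le _)) (φ N) ((le_max_right _ _).trans (hφ.id_le _))
    rw [Subtype.dist_eq, ← hgd, ← hgd] at h3
    simp only [Function.comp_apply] at h1 h2
    rw [← dist_smul (g (φ (N + m))), dist_comm] at h1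
    rw [← dist_smul (g (φ N))] at h2
    rw [Metric.mem_ball, ← dist_smul (g (φ N)), smul_smul, mul_inv_cancel_left]
    linarith [dist_triangle4 (g (φ (N + m)) • a) (g (φ (N + m)) • d (φ (N + m)))
      (g (φ N) • d (φ N)) (g (φ N) • a)]
  have hsub : Tendsto (fun m => φ (N + m)) atTop atTop :=
    hφ.tendsto_atTop.comp (tendsto_add_atTop_nat N |>.congr fun m => add_comm _ _)
  have hc : CauchySeq fun m => (u (φ (N + m)) : X) :=
    (uniformContinuous_subtype_val.comp_cauchySeq hu).comp_tendsto hsub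
  obtain ⟨y, hy, hylim⟩ := cauchySeq_tendsto_of_isComplete hS.isComplete hmem hc
  have hyD : y ∈ orbitSet H D := by
    obtain ⟨k, -, x, hx, rfl⟩ := mem_iUnion₂.1 hy
    exact mem_iUnion.2 ⟨_, x, hx, rfl⟩
  refine ⟨⟨y, hyD⟩, tendsto_nhds_of_cauchySeq_of_subseq hu hsub ?_⟩
  exact tendsto_subtype_rng.2 hylim

/-- Two almost closest points of a convex set are close to each other. -/
theorem dist_sq_le_of_infDist (hX : IsCAT0 X) {C : Set X} (hconv : IsGeodConvex C) {x a b : X}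
    {R : ℝ} (ha : a ∈ C) (hb : b ∈ C) (ha' : dist x a ≤ R) (hb' : dist x b ≤ R) :
    dist a b ^ 2 ≤ 4 * (R ^ 2 - Metric.infDist x C ^ 2) := by
  have ht : (1 / 2 : ℝ) ∈ Icc (0 : ℝ) 1 := by constructor <;> norm_num
  have h1 := dist_sq_seg_le hX x a b ht
  have h2 := Metric.infDist_le_dist_of_mem (x := x) (hconv.seg_mem hX ha hb ht)
  have h3 := pow_le_pow_left₀ Metric.infDist_nonneg h2 2
  have h4 := pow_le_pow_left₀ dist_nonneg ha' 2
  have h5 := pow_le_pow_left₀ dist_nonneg hb' 2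
  linarith

theorem exists_dist_eq_infDist (hX : IsCAT0 X) {C : Set X} (hC : IsComplete C)
    (hne : C.Nonempty) (hconv : IsGeodConvex C) (x : X) :
    ∃ p ∈ C, dist x p = Metric.infDist x C := by
  set r := Metric.infDist x C
  have hr : 0 ≤ r := Metric.infDist_nonneg
  have h : ∀ n : ℕ, ∃ c ∈ C, dist x c < r + 1 / (n + 1) := fun n =>
    (Metric.infDist_lt_iff hne).1 (lt_add_of_pos_right _ Nat.one_div_pos_of_nat)
  choose c hc hcd using h
  have h0 : Tendsto (fun n : ℕ => r + 1 / ((n : ℝ) + 1)) atTop (𝓝 r) := by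
    simpa using (tendsto_const_nhds (x := r)).add (tendsto_one_div_add_atTop_nhds_zero_nat (𝕜 := ℝ))
  have hcauchy : CauchySeq c := by
    refine cauchySeq_of_le_tendsto_0
      (fun n : ℕ => √(4 * ((r + 1 / ((n : ℝ) + 1)) ^ 2 - r ^ 2))) (fun n m N hn hm => ?_) ?_
    · have hle : ∀ k, N ≤ k → dist x (c k) ≤ r + 1 / ((N : ℝ) + 1) := fun k hk =>
        (hcd k).le.trans (add_le_add le_rfl (Nat.one_div_le_one_div hk))
      exact Real.le_sqrt_of_sq_le
        (dist_sq_le_of_infDist hX hconv (hc n) (hc m) (hle n hn) (hle m hm))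
    · have := (((h0.pow 2).sub_const (r ^ 2)).const_mul 4).sqrt
      simpa using this
  obtain ⟨p, hp, hlim⟩ := cauchySeq_tendsto_of_isComplete hC hc hcauchy
  refine ⟨p, hp, le_antisymm ?_ (Metric.infDist_le_dist_of_mem hp)⟩
  exact le_of_tendsto_of_tendsto' (tendsto_const_nhds.dist hlim) h0 fun n => (hcd n).le

/-- A nonempty complete geodesically convex set, onto which closest-point projection is defined. -/
structure IsProjectible (C : Set X) : Prop where
  complete : IsComplete C
  nonempty : C.Nonempty
  convex : IsGeodConvex C

variable {C : Set X}

theorem proj_spec (hX : IsCAT0 X) (hC : IsProjectible C) (x : X) :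
    proj C x ∈ C ∧ dist x (proj C x) = Metric.infDist x C := by
  have h : ∃ p ∈ C, ∀ p' ∈ C, dist x p ≤ dist x p' := by
    obtain ⟨p, hp, e⟩ := exists_dist_eq_infDist hX hC.complete hC.nonempty hC.convex x
    exact ⟨p, hp, fun p' hp' => e.le.trans (Metric.infDist_le_dist_of_mem hp')⟩
  rw [proj, dif_pos h]
  exact ⟨h.choose_spec.1, le_antisymm ((Metric.le_infDist hC.nonempty).2 fun _ hy =>
    h.choose_spec.2 _ hy) (Metric.infDist_le_dist_of_mem h.choose_spec.1)⟩

/-- The projections of x and of y are both almost closest to x, with error 2d(y,x). -/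
theorem continuous_proj (hX : IsCAT0 X) (hC : IsProjectible C) : Continuous (proj C) := by
  refine continuous_iff_continuousAt.2 fun x => tendsto_iff_dist_tendsto_zero.2 ?_
  set r := Metric.infDist x C
  have hlim : Tendsto (fun y => √(4 * ((r + 2 * dist y x) ^ 2 - r ^ 2))) (𝓝 x) (𝓝 0) := by
    have h : Continuous fun y => √(4 * ((r + 2 * dist y x) ^ 2 - r ^ 2)) := by fun_prop
    simpa using h.tendsto x
  refine squeeze_zero (fun _ => dist_nonneg) (fun y => Real.le_sqrt_of_sq_le ?_) hlim
  obtain ⟨h1, h2⟩ := proj_spec hX hC x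
  obtain ⟨h3, h4⟩ := proj_spec hX hC y
  refine dist_sq_le_of_infDist hX hC.convex h3 h1 ?_ ?_
  · have := Metric.infDist_le_infDist_add_dist (s := C) (x := y) (y := x)
    linarith [dist_triangle_left x (proj C y) y]
  · linarith [dist_nonneg (x := y) (y := x)]

theorem infDist_seg_le (hX : IsCAT0 X) (hC : IsProjectible C) (x y : X) {t : ℝ}
    (ht : t ∈ Icc (0 : ℝ) 1) :
    Metric.infDist (seg x y t) C ≤ (1 - t) * Metric.infDist x C + t * Metric.infDist y C := by
  obtain ⟨h1, h2⟩ := proj_spec hX hC x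
  obtain ⟨h3, h4⟩ := proj_spec hX hC y
  rw [← h2, ← h4]
  exact (Metric.infDist_le_dist_of_mem (hC.convex.seg_mem hX h1 h3 ht)).trans
    (dist_seg_seg_le hX _ _ _ _ ht)

/-- The angle at the foot of a perpendicular is not acute. -/
theorem infDist_sq_add_dist_sq_le (hX : IsCAT0 X) (hC : IsProjectible C) (x : X) {c : X}
    (hc : c ∈ C) : Metric.infDist x C ^ 2 + dist (proj C x) c ^ 2 ≤ dist x c ^ 2 := by
  obtain ⟨h1, h2⟩ := proj_spec hX hC x
  set p := proj C x
  -- The point at ratio t from p to c is in C, hence no closer to x than p. Bruhat–Tits, divided by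
  -- t, gives the bound; then t tends to 0.
  have key : ∀ t ∈ Ioo (0 : ℝ) 1,
      Metric.infDist x C ^ 2 + (1 - t) * dist p c ^ 2 ≤ dist x c ^ 2 := fun t ht => by
    have ht' : t ∈ Icc (0 : ℝ) 1 := ⟨ht.1.le, ht.2.le⟩
    have h3 := dist_sq_seg_le hX x p c ht'
    have h4 := pow_le_pow_left₀ Metric.infDist_nonneg
      (Metric.infDist_le_dist_of_mem (x := x) (hC.convex.seg_mem hX h1 hc ht')) 2
    rw [h2] at h3
    refine le_of_mul_le_mul_left ?_ ht.1
    linarith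
  have hlim : Tendsto (fun t : ℝ => Metric.infDist x C ^ 2 + (1 - t) * dist p c ^ 2) (𝓝[>] 0)
      (𝓝 (Metric.infDist x C ^ 2 + (1 - 0) * dist p c ^ 2)) :=
    ((Continuous.tendsto (by fun_prop) 0).mono_left nhdsWithin_le_nhds)
  rw [sub_zero, one_mul] at hlim
  exact le_of_tendsto hlim (by filter_upwards [Ioo_mem_nhdsGT one_pos] with t ht using key t ht)

theorem comparisonAngle_le_pi_div_two {o x y : X} (h : dist x y ^ 2 ≤ dist o x ^ 2 + dist o y ^ 2) :
    comparisonAngle o x y ≤ Real.pi / 2 :=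
  Real.arccos_le_pi_div_two.2 (div_nonneg (by linarith) (by positivity))

/-- A geodesic that starts at an obtuse angle with the perpendicular moves away from `C`. -/
theorem infDist_lt_infDist_seg (hX : IsCAT0 X) (hC : IsProjectible C) {q q' : X} (hne : q ≠ q')
    (hangle : Real.pi / 2 < angleTo C q q') (hq : 0 < Metric.infDist q C) {t : ℝ}
    (ht : t ∈ Ioc (0 : ℝ) 1) : Metric.infDist q C < Metric.infDist (seg q q' t) C := by
  -- Otherwise convexity of the distance to C keeps it at most d(q,C) up to parameter t, which makes
  -- every small comparison angle at most π/2.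
  by_contra! hle
  refine hangle.not_ge (limsup_le_of_le ?_ ?_)
  -- A real `limsup` is bounded by an eventual bound only if the function is not eventually
  -- arbitrarily negative.
  · exact IsCoboundedUnder.of_frequently_ge (a := 0)
      (Frequently.of_forall fun _ => Real.arccos_nonneg _)
  obtain ⟨hp, hqp⟩ := proj_spec hX hC q
  set p := proj C q
  have hd : 0 < dist q q' := dist_pos.2 hne
  have h1 : ∀ᶠ s in 𝓝[>] (0 : ℝ), s ∈ Ioo 0 (t * dist q q') := Ioo_mem_nhdsGT (mul_pos ht.1 hd)
  have h2 : ∀ᶠ s in 𝓝[>] (0 : ℝ), s ∈ Ioo 0 (dist q p) := Ioo_mem_nhdsGT (hqp ▸ hq)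
  filter_upwards [h1.prod_mk h2]
  rintro ⟨s, u⟩ ⟨hs, hu⟩
  dsimp only at hs hu ⊢
  apply comparisonAngle_le_pi_div_two
  set x := geod q q' s with hx
  have hs' : s ∈ Icc 0 (dist q q') :=
    ⟨hs.1.le, hs.2.le.trans (mul_le_of_le_one_left hd.le ht.2)⟩
  rw [(isGeodesic_geod hX q q').dist_left hs',
    (isGeodesic_geod hX q p).dist_left ⟨hu.1.le, hu.2.le⟩]
  have hxC : Metric.infDist x C ≤ Metric.infDist q C := by
    have hr : s / (t * dist q q') ∈ Icc (0 : ℝ) 1 :=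
      ⟨div_nonneg hs.1.le (hs.1.trans hs.2).le, div_le_one_of_le₀ hs.2.le (hs.1.trans hs.2).le⟩
    have e : x = seg q (seg q q' t) (s / (t * dist q q')) := by
      rw [seg_seg hX _ _ ⟨ht.1.le, ht.2⟩ hr, seg, hx]
      congr 1
      have := ht.1.ne'
      field_simp
    have := infDist_seg_le hX hC q (seg q q' t) hr
    rw [← e] at this
    nlinarith [hr.1, hr.2, mul_le_mul_of_nonneg_left hle hr.1]
  obtain ⟨hc, hxc⟩ := proj_spec hX hC x
  have hqx : dist q x = s := (isGeodesic_geod hX q q').dist_left hs'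
  -- The quadrilateral x, proj x, p, q: the perpendicular at p absorbs the diagonal from q to proj
  -- x, and d(x,C) ≤ d(q,p).
  have hxp : dist x p ^ 2 ≤ s ^ 2 + dist q p ^ 2 := by
    have h3 := dist_sq_add_dist_sq_le hX x (proj C x) p q
    have h4 := infDist_sq_add_dist_sq_le hX hC q hc
    have h5 := pow_le_pow_left₀ Metric.infDist_nonneg hxC 2
    rw [hxc, hqx, dist_comm p q, dist_comm (proj C x) p] at h3
    rw [← hqp] at h4 h5
    linarith
  have ht' : u / dist q p ∈ Icc (0 : ℝ) 1 :=
    ⟨div_nonneg hu.1.le dist_nonneg, div_le_one_of_le₀ hu.2.le dist_nonneg⟩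
  -- Passes from p to the point at distance u from q on the geodesic qp; with ratio u/d(q,p) the
  -- terms collapse to s² + u².
  have h6 := dist_sq_seg_le hX x q p ht'
  have hqp' : dist q p ≠ 0 := (hqp ▸ hq).ne'
  rw [seg, div_mul_cancel₀ _ hqp', dist_comm x q, hqx] at h6
  have h7 := mul_le_mul_of_nonneg_left hxp ht'.1
  have h8 : (u / dist q p) ^ 2 * dist q p ^ 2 = u ^ 2 := by field_simp
  linarith

end Projection

/-! ### Barycentric coordinates in a simplicial complex -/

section Barycentric

variable {E : Type*} [AddCommGroup E] [Module ℝ E]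

/-- `w` is a system of convex weights. -/
structure IsConvexWeight {I : Type*} (w : I →₀ ℝ) : Prop where
  nonneg : ∀ i, 0 ≤ w i
  total : Finsupp.linearCombination ℝ (fun _ => (1 : ℝ)) w = 1

/-- The convex combination of points of `E` with the given weights. -/
abbrev combine : (E →₀ ℝ) →ₗ[ℝ] E := Finsupp.linearCombination ℝ id

theorem linearCombination_eq_sum_of_support_subset {M : Type*} [AddCommGroup M] [Module ℝ M]
    {I : Type*} (g : I → M) {w : I →₀ ℝ} {s : Finset I} (hs : w.support ⊆ s) :
    Finsupp.linearCombination ℝ g w = ∑ v ∈ s, w v • g v := by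
  rw [Finsupp.linearCombination_apply]
  exact Finsupp.sum_of_support_subset _ hs _ (by simp)

theorem mem_convexHull_finset_iff {s : Finset E} {x : E} :
    x ∈ convexHull ℝ (s : Set E) ↔
      ∃ w : E →₀ ℝ, IsConvexWeight w ∧ w.support ⊆ s ∧ combine w = x := by
  classical
  rw [Finset.mem_convexHull']
  constructor
  · rintro ⟨w, h0, h1, h2⟩
    set w' : E →₀ ℝ := Finsupp.onFinset s (fun v => if v ∈ s then w v else 0)
      (fun v hv => by by_contra h; simp [h] at hv)
    have hw' : ∀ v ∈ s, w' v = w v := fun v hv => by simp [w', hv]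
    have hs : w'.support ⊆ s := Finsupp.support_onFinset_subset
    refine ⟨w', ⟨fun v => ?_, ?_⟩, hs, ?_⟩
    · simp only [w', Finsupp.onFinset_apply]
      split_ifs with hv
      exacts [h0 v hv, le_rfl]
    · rw [linearCombination_eq_sum_of_support_subset _ hs]
      refine Eq.trans ?_ h1
      exact Finset.sum_congr rfl fun v hv => by simp [hw' v hv]
    · rw [combine, linearCombination_eq_sum_of_support_subset _ hs, ← h2]
      exact Finset.sum_congr rfl fun v hv => by simp [hw' v hv]
  · rintro ⟨w, ⟨h0, h1⟩, hs, rfl⟩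
    rw [linearCombination_eq_sum_of_support_subset _ hs] at h1
    refine ⟨w, fun v _ => h0 v, by simpa using h1, ?_⟩
    rw [combine, linearCombination_eq_sum_of_support_subset _ hs]
    rfl

theorem eq_of_combine_eq {s : Finset E} (hs : AffineIndependent ℝ ((↑) : s → E)) {w w' : E →₀ ℝ}
    (hw : w.support ⊆ s) (hw' : w'.support ⊆ s)
    (htotal : Finsupp.linearCombination ℝ (fun _ => (1 : ℝ)) w =
      Finsupp.linearCombination ℝ (fun _ => (1 : ℝ)) w')
    (h : combine w = combine w') : w = w' := by
  classical
  rw [combine, linearCombination_eq_sum_of_support_subset _ hw,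
    linearCombination_eq_sum_of_support_subset _ hw', ← Finset.sum_coe_sort s,
    ← Finset.sum_coe_sort s] at h
  rw [linearCombination_eq_sum_of_support_subset _ hw,
    linearCombination_eq_sum_of_support_subset _ hw', ← Finset.sum_coe_sort s,
    ← Finset.sum_coe_sort s] at htotal
  have key := affineIndependent_iff.1 hs Finset.univ (fun v => w v - w' v)
    (by simpa [sub_eq_zero] using htotal)
    (by simpa [sub_smul, sub_eq_zero] using h)
  ext v
  by_cases hv : v ∈ s
  · exact sub_eq_zero.1 (key ⟨v, hv⟩ (Finset.mem_univ _))
  · rw [Finsupp.notMem_support_iff.1 fun h => hv (hw h),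
      Finsupp.notMem_support_iff.1 fun h => hv (hw' h)]

variable (S : Geometry.SimplicialComplex ℝ E)

/-- `w` is the system of barycentric coordinates of `y` with respect to a simplex of `S`. -/
structure IsBary (y : E) (w : E →₀ ℝ) : Prop where
  weight : IsConvexWeight w
  face : ∃ t ∈ S.faces, w.support ⊆ t
  combine_eq : combine w = y

open Classical in
/-- The barycentric coordinates of a point of the complex `S`. -/
def bary (y : E) : E →₀ ℝ := if h : ∃ w, IsBary S y w then h.choose else 0

variable {S}

/-- Two simplices meet in the hull of their common vertices, so y has coordinates supported there;
affine independence of the first simplex identifies them with w. -/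
theorem IsBary.eq_of_mem_convexHull {y : E} {w : E →₀ ℝ} (h : IsBary S y w) {t : Finset E}
    (ht : t ∈ S.faces) (hy : y ∈ convexHull ℝ (t : Set E)) :
    ∃ u, IsConvexWeight u ∧ u.support ⊆ t ∧ u = w := by
  classical
  obtain ⟨s, hs, hws⟩ := h.face
  have hys : y ∈ convexHull ℝ (s : Set E) :=
    mem_convexHull_finset_iff.2 ⟨w, h.weight, hws, h.combine_eq⟩
  have hyst := S.inter_subset_convexHull hs ht ⟨hys, hy⟩
  rw [← Finset.coe_inter] at hyst
  obtain ⟨u, hu, hust, hcu⟩ := mem_convexHull_finset_iff.1 hyst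
  refine ⟨u, hu, hust.trans Finset.inter_subset_right, ?_⟩
  exact eq_of_combine_eq (S.indep hs) (hust.trans Finset.inter_subset_left) hws
    (hu.total.trans h.weight.total.symm) (hcu.trans h.combine_eq.symm)

theorem IsBary.support_subset {y : E} {w : E →₀ ℝ} (h : IsBary S y w) {t : Finset E}
    (ht : t ∈ S.faces) (hy : y ∈ convexHull ℝ (t : Set E)) : w.support ⊆ t := by
  obtain ⟨u, -, hu, rfl⟩ := h.eq_of_mem_convexHull ht hy
  exact hu

theorem IsBary.unique {y : E} {w w' : E →₀ ℝ} (h : IsBary S y w) (h' : IsBary S y w') :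
    w = w' := by
  obtain ⟨t, ht, hwt⟩ := h.face
  refine eq_of_combine_eq (S.indep ht) hwt (h'.support_subset ht ?_)
    (h.weight.total.trans h'.weight.total.symm) (h.combine_eq.trans h'.combine_eq.symm)
  exact mem_convexHull_finset_iff.2 ⟨w, h.weight, hwt, h.combine_eq⟩

theorem IsBary.bary_eq {y : E} {w : E →₀ ℝ} (h : IsBary S y w) : bary S y = w := by
  have h' : ∃ w, IsBary S y w := ⟨w, h⟩
  rw [bary, dif_pos h']
  exact h'.choose_spec.unique h

theorem isBary_bary_of_mem_convexHull {y : E} {t : Finset E} (ht : t ∈ S.faces)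
    (hy : y ∈ convexHull ℝ (t : Set E)) : IsBary S y (bary S y) := by
  obtain ⟨w, hw, hwt, e⟩ := mem_convexHull_finset_iff.1 hy
  have h : IsBary S y w := ⟨hw, ⟨t, ht, hwt⟩, e⟩
  rwa [h.bary_eq]

theorem isBary_bary {y : E} (hy : y ∈ S.space) : IsBary S y (bary S y) := by
  obtain ⟨t, ht, hyt⟩ := S.mem_space_iff.1 hy
  exact isBary_bary_of_mem_convexHull ht hyt

theorem IsConvexWeight.support_nonempty {I : Type*} {w : I →₀ ℝ} (h : IsConvexWeight w) :
    w.support.Nonempty := by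
  rw [Finset.nonempty_iff_ne_empty, Ne, Finsupp.support_eq_empty]
  rintro rfl
  simpa using h.total

theorem support_bary_mem_faces {y : E} (hy : y ∈ S.space) : (bary S y).support ∈ S.faces := by
  have h := isBary_bary hy
  obtain ⟨t, ht, hwt⟩ := h.face
  exact S.down_closed ht hwt h.weight.support_nonempty

theorem mem_convexHull_support_bary {y : E} (hy : y ∈ S.space) :
    y ∈ convexHull ℝ ((bary S y).support : Set E) :=
  mem_convexHull_finset_iff.2 ⟨_, (isBary_bary hy).weight, subset_rfl, (isBary_bary hy).combine_eq⟩

theorem support_bary_subset {y : E} {t : Finset E} (ht : t ∈ S.faces)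
    (hy : y ∈ convexHull ℝ (t : Set E)) : (bary S y).support ⊆ t :=
  (isBary_bary_of_mem_convexHull ht hy).support_subset ht hy

theorem IsConvexWeight.combine_mem {I : Type*} {w : I →₀ ℝ} (h : IsConvexWeight w)
    {A : Set E} (hA : Convex ℝ A) {g : I → E} (hg : ∀ i ∈ w.support, g i ∈ A) :
    Finsupp.linearCombination ℝ g w ∈ A := by
  have := h.total
  rw [linearCombination_eq_sum_of_support_subset _ subset_rfl] at this ⊢
  exact hA.sum_mem (fun i _ => h.nonneg i) (by simpa using this) hg

/-- Barycentric coordinates are affine on each simplex. -/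
theorem isBary_combine {s : Finset E} (hs : s ∈ S.faces) {u : E →₀ ℝ} (hu : IsConvexWeight u)
    (hus : (u.support : Set E) ⊆ convexHull ℝ (s : Set E)) :
    IsBary S (combine u) (Finsupp.linearCombination ℝ (bary S) u) := by
  classical
  have hb : ∀ a ∈ u.support, IsBary S a (bary S a) := fun a ha =>
    isBary_bary_of_mem_convexHull hs (hus ha)
  have e := linearCombination_eq_sum_of_support_subset (bary S) (subset_refl u.support)
  refine ⟨⟨fun v => ?_, ?_⟩, ⟨s, hs, ?_⟩, ?_⟩
  · rw [e, Finsupp.finsetSum_apply]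
    exact Finset.sum_nonneg fun a ha => mul_nonneg (hu.nonneg a) ((hb a ha).weight.nonneg v)
  · rw [e, map_sum]
    refine Eq.trans ?_ hu.total
    rw [linearCombination_eq_sum_of_support_subset _ (subset_refl u.support)]
    exact Finset.sum_congr rfl fun a ha => by rw [map_smul, (hb a ha).weight.total]
  · rw [e]
    refine (Finsupp.support_finsetSum).trans (Finset.biUnion_subset.2 fun a ha => ?_)
    exact Finsupp.support_smul.trans (support_bary_subset hs (hus ha))
  · rw [e, map_sum, combine, linearCombination_eq_sum_of_support_subset _ subset_rfl]
    exact Finset.sum_congr rfl fun a ha => by rw [map_smul, (hb a ha).combine_eq, id]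

/-- Faces are extreme. -/
theorem mem_convexHull_of_combine_mem {s t : Finset E} (hs : s ∈ S.faces) (ht : t ∈ S.faces)
    {u : E →₀ ℝ} (hu : IsConvexWeight u)
    (hus : (u.support : Set E) ⊆ convexHull ℝ (s : Set E))
    (hy : combine u ∈ convexHull ℝ (t : Set E)) {a : E} (ha : a ∈ u.support) :
    a ∈ convexHull ℝ (t : Set E) := by
  have hb := isBary_bary_of_mem_convexHull hs (hus ha)
  refine mem_convexHull_finset_iff.2 ⟨bary S a, hb.weight, fun v hv => ?_, hb.combine_eq⟩
  by_contra hvt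
  -- The v-coordinate of the combination vanishes because v is not in t. It is a sum of nonnegative
  -- terms, so the term of a vanishes too.
  have h0 : Finsupp.linearCombination ℝ (bary S) u v = 0 := by
    by_contra h
    exact hvt ((isBary_combine hs hu hus).support_subset ht hy (Finsupp.mem_support_iff.2 h))
  rw [linearCombination_eq_sum_of_support_subset _ subset_rfl, Finsupp.finsetSum_apply] at h0
  have h1 := (Finset.sum_eq_zero_iff_of_nonneg (fun b hb' => mul_nonneg (hu.nonneg b)
    ((isBary_bary_of_mem_convexHull hs (hus hb')).weight.nonneg v))).1 h0 a ha
  rcases mul_eq_zero.1 h1 with h | h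
  · exact Finsupp.mem_support_iff.1 ha h
  · exact Finsupp.mem_support_iff.1 hv h

theorem exists_isConvexWeight_support_eq {I : Type*} {s : Finset I} (hs : s.Nonempty) :
    ∃ u : I →₀ ℝ, IsConvexWeight u ∧ u.support = s := by
  classical
  have hc : (0 : ℝ) < s.card := by exact_mod_cast hs.card_pos
  set u : I →₀ ℝ := Finsupp.onFinset s (fun v => if v ∈ s then (s.card : ℝ)⁻¹ else 0)
      (fun v hv => by by_contra h; simp [h] at hv)
  have hu : ∀ v, u v = if v ∈ s then (s.card : ℝ)⁻¹ else 0 := fun v => rfl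
  have hs' : u.support = s := by
    ext v
    simp [hu, hs.ne_empty]
  refine ⟨u, ⟨fun v => ?_, ?_⟩, hs'⟩
  · rw [hu]
    split_ifs <;> positivity
  · rw [linearCombination_eq_sum_of_support_subset _ hs'.subset]
    simp [hu, hc.ne']

end Barycentric

/-! ### Subdivisions and the drift under shrinking -/

section Subdivision

variable {E : Type*} [AddCommGroup E] [Module ℝ E]
variable {S S' S'' : Geometry.SimplicialComplex ℝ E}

/-- A finite set in a simplex has a carrier, namely the carrier of any convex combination of the set
with positive weights. -/
theorem exists_isCarrier {s' s₁ : Finset E} (hs' : s'.Nonempty) (hs₁ : s₁ ∈ S.faces)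
    (h : (s' : Set E) ⊆ convexHull ℝ (s₁ : Set E)) :
    ∃ c, IsCarrier S s' c ∧ ∃ u : E →₀ ℝ, IsConvexWeight u ∧ u.support = s' ∧
      c = (bary S (combine u)).support := by
  obtain ⟨u, hu, rfl⟩ := exists_isConvexWeight_support_eq hs'
  have hy : combine u ∈ convexHull ℝ (s₁ : Set E) :=
    hu.combine_mem (convex_convexHull ℝ _) h
  have hyS : combine u ∈ S.space := S.mem_space_iff.2 ⟨s₁, hs₁, hy⟩
  have hc := support_bary_mem_faces hyS
  refine ⟨_, ⟨hc, convexHull_min (fun a ha => ?_) (convex_convexHull ℝ _), fun t ht hut => ?_⟩,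
    u, hu, rfl, rfl⟩
  · exact mem_convexHull_of_combine_mem hs₁ hc hu h (mem_convexHull_support_bary hyS) ha
  · exact Finset.card_le_card (support_bary_subset ht
      (hu.combine_mem (convex_convexHull ℝ _) fun a ha => hut (subset_convexHull ℝ _ ha)))

/-- In a subdivision, the face that carries a point is contained in each simplex of the original
complex that contains the point. -/
theorem IsLocallyFiniteSubdivision.support_bary_subset (hsub : IsLocallyFiniteSubdivision S S')
    {s : Finset E} (hs : s ∈ S.faces) {y : E} (hy : y ∈ convexHull ℝ (s : Set E)) :
    convexHull ℝ ((bary S' y).support : Set E) ⊆ convexHull ℝ (s : Set E) := by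
  have hyS' : y ∈ S'.space := hsub.space_eq ▸ S.mem_space_iff.2 ⟨s, hs, hy⟩
  obtain ⟨s₁, hs₁, hss₁⟩ := hsub.subset_simplex _ (support_bary_mem_faces hyS')
  have hb := isBary_bary hyS'
  refine convexHull_min (fun a ha => ?_) (convex_convexHull ℝ _)
  refine mem_convexHull_of_combine_mem hs₁ hs hb.weight ((subset_convexHull ℝ _).trans hss₁) ?_ ha
  rwa [hb.combine_eq]

theorem IsLocallyFiniteSubdivision.exists_isCarrier (hsub : IsLocallyFiniteSubdivision S S')
    {s'' s₁' s : Finset E} (hne : s''.Nonempty) (hs₁' : s₁' ∈ S'.faces)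
    (h : (s'' : Set E) ⊆ convexHull ℝ (s₁' : Set E)) (hs : s ∈ S.faces)
    (hs'' : (s'' : Set E) ⊆ convexHull ℝ (s : Set E)) :
    ∃ c, IsCarrier S' s'' c ∧ convexHull ℝ (c : Set E) ⊆ convexHull ℝ (s : Set E) := by
  obtain ⟨c, hc, u, hu, rfl, rfl⟩ := PushOff.exists_isCarrier hne hs₁' h
  exact ⟨_, hc, hsub.support_bary_subset hs (hu.combine_mem (convex_convexHull ℝ _) hs'')⟩

theorem IsLocallyFiniteSubdivision.refl (S : Geometry.SimplicialComplex ℝ E) :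
    IsLocallyFiniteSubdivision S S where
  space_eq := rfl
  subset_simplex s hs := ⟨s, hs, subset_rfl⟩
  finite s hs := s.powerset.finite_toSet.subset fun _ ht =>
    Finset.mem_coe.2 (Finset.mem_powerset.2 ((S.face_subset_face_iff ht.1 hs).1 ht.2))

theorem IsLocallyFiniteSubdivision.trans (h : IsLocallyFiniteSubdivision S S')
    (h' : IsLocallyFiniteSubdivision S' S'') : IsLocallyFiniteSubdivision S S'' where
  space_eq := h'.space_eq.trans h.space_eq
  subset_simplex s hs := by
    obtain ⟨s', hs', hss'⟩ := h'.subset_simplex s hs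
    obtain ⟨s'', hs'', hss''⟩ := h.subset_simplex s' hs'
    exact ⟨s'', hs'', hss'.trans hss''⟩
  finite s hs := by
    refine ((h.finite s hs).biUnion fun s' hs' => h'.finite s' hs'.1).subset ?_
    rintro t ⟨ht, hts⟩
    obtain ⟨t₁, ht₁, htt₁⟩ := h'.subset_simplex t ht
    -- The face t₁ may stick out of s; the carrier of t does not, so t is counted over one of the
    -- finitely many faces of S' in s.
    obtain ⟨c, hc, hcs⟩ := h.exists_isCarrier (S''.nonempty_of_mem_faces ht) ht₁
      ((subset_convexHull ℝ _).trans htt₁) hs ((subset_convexHull ℝ _).trans hts)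
    exact mem_biUnion (show c ∈ _ from ⟨hc.1, hcs⟩) ⟨ht, hc.2.1⟩

/-- The face of S' that carries v lies in the simplex {v}, so it is {v}. -/
theorem IsLocallyFiniteSubdivision.vertices_subset (h : IsLocallyFiniteSubdivision S S') :
    S.vertices ⊆ S'.vertices := by
  intro v hv
  have hvS' : v ∈ S'.space := h.space_eq ▸ S.vertices_subset_space hv
  have h1 := h.support_bary_subset (s := {v}) hv (y := v) (by simp)
  have h2 : (bary S' v).support ⊆ {v} := by
    intro a ha
    simpa using h1 (subset_convexHull ℝ _ ha)
  have h3 := support_bary_mem_faces hvS'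
  rwa [(Finset.Nonempty.subset_singleton_iff (S'.nonempty_of_mem_faces h3)).1 h2] at h3

variable {X : Type*} [MetricSpace X] {lam : ℝ} {ι ι' ι'' : E → X}

/-- The estimates satisfied by an `n`-fold `lam`-shrinking subdivision. -/
structure IsShrunk (lam : ℝ) (S : Geometry.SimplicialComplex ℝ E) (ι : E → X) (n : ℕ)
    (S' : Geometry.SimplicialComplex ℝ E) (ι' : E → X) : Prop where
  subdivision : IsLocallyFiniteSubdivision S S'
  ediam_le : ∀ s ∈ S.faces, ∀ s' ∈ S'.faces, (s' : Set E) ⊆ convexHull ℝ (s : Set E) →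
    Metric.ediam (ι' '' (s' : Set E)) ≤ ENNReal.ofReal lam ^ n * Metric.ediam (ι '' (s : Set E))
  edist_le : ∀ s ∈ S.faces, ∀ v ∈ S'.vertices, v ∈ convexHull ℝ (s : Set E) → ∀ w ∈ s,
    edist (ι' v) (ι w) ≤
      (∑ k ∈ Finset.range n, ENNReal.ofReal lam ^ k) * Metric.ediam (ι '' (s : Set E))

theorem IsShrinkingSubdivision.ediam_image_le (h : IsShrinkingSubdivision lam S' ι' S'' ι'')
    (hsub : IsLocallyFiniteSubdivision S S') {s s'' : Finset E} (hs : s ∈ S.faces)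
    (hs'' : s'' ∈ S''.faces) (hss : (s'' : Set E) ⊆ convexHull ℝ (s : Set E)) :
    ∃ c ∈ S'.faces, convexHull ℝ (c : Set E) ⊆ convexHull ℝ (s : Set E) ∧
      Metric.ediam (ι'' '' (s'' : Set E)) ≤
        ENNReal.ofReal lam * Metric.ediam (ι' '' (c : Set E)) := by
  obtain ⟨s₁, hs₁, h₁⟩ := h.subdivision.subset_simplex s'' hs''
  obtain ⟨c, hc, hcs⟩ := hsub.exists_isCarrier (S''.nonempty_of_mem_faces hs'') hs₁
    ((subset_convexHull ℝ _).trans h₁) hs hss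
  exact ⟨c, hc.1, hcs, h.shrinking s'' hs'' c hc⟩

theorem IsShrinkingSubdivision.isShrunk (h : IsShrinkingSubdivision lam S ι S' ι') :
    IsShrunk lam S ι 1 S' ι' where
  subdivision := h.subdivision
  ediam_le s hs s' hs' hss := by
    obtain ⟨c, hc, hcs, hle⟩ := h.ediam_image_le (.refl S) hs hs' hss
    rw [pow_one]
    refine hle.trans (mul_le_mul_right (Metric.ediam_mono (image_mono ?_)) _)
    exact_mod_cast (S.face_subset_face_iff hc hs).1 hcs
  edist_le s hs v hv hvs w hw := by
    have hwS : w ∈ S.vertices := by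
      rw [S.vertices_eq]
      exact mem_biUnion hs hw
    rw [Finset.sum_range_one, pow_zero, one_mul, ← h.extends_map w hwS]
    refine (Metric.edist_le_ediam_of_mem ?_ ?_).trans (h.diam_le s hs)
    · exact mem_image_of_mem _ ⟨hv, hvs⟩
    · exact mem_image_of_mem _ ⟨h.subdivision.vertices_subset hwS, subset_convexHull ℝ _ hw⟩

theorem IsShrunk.succ {n : ℕ} (h : IsShrunk lam S ι n S' ι')
    (h' : IsShrinkingSubdivision lam S' ι' S'' ι'') : IsShrunk lam S ι (n + 1) S'' ι'' where
  subdivision := h.subdivision.trans h'.subdivision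
  ediam_le s hs s'' hs'' hss := by
    obtain ⟨c, hc, hcs, hle⟩ := h'.ediam_image_le h.subdivision hs hs'' hss
    rw [pow_succ', mul_assoc]
    exact hle.trans (mul_le_mul_right
      (h.ediam_le s hs c hc ((subset_convexHull ℝ _).trans hcs)) _)
  edist_le s hs v hv hvs w hw := by
    have hvS' : v ∈ S'.space := h.subdivision.space_eq ▸ S.mem_space_iff.2 ⟨s, hs, hvs⟩
    have hc := support_bary_mem_faces hvS'
    have hcs := h.subdivision.support_bary_subset hs hvs
    -- A vertex u of the face of S' carrying v links the stages: from v to u costs the new term with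
    -- λ^n, and u is already controlled.
    obtain ⟨u, hu⟩ := S'.nonempty_of_mem_faces hc
    have huS' : u ∈ S'.vertices := by
      rw [S'.vertices_eq]
      exact mem_biUnion hc hu
    have h1 : edist (ι'' v) (ι'' u) ≤ ENNReal.ofReal lam ^ n * Metric.ediam (ι '' (s : Set E)) := by
      refine (Metric.edist_le_ediam_of_mem ?_ ?_).trans ((h'.diam_le _ hc).trans
        (h.ediam_le s hs _ hc ((subset_convexHull ℝ _).trans hcs)))
      · exact mem_image_of_mem _ ⟨hv, mem_convexHull_support_bary hvS'⟩
      · exact mem_image_of_mem _ ⟨h'.subdivision.vertices_subset huS', subset_convexHull ℝ _ hu⟩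
    have h2 := h.edist_le s hs u huS' (hcs (subset_convexHull ℝ _ hu)) w hw
    rw [h'.extends_map u huS'] at h1
    rw [Finset.sum_range_succ, add_comm, add_mul]
    exact (edist_triangle _ _ _).trans (add_le_add h1 h2)

theorem IsShrinkingSubdivisionOfOrder.isShrunk {n : ℕ}
    (h : IsShrinkingSubdivisionOfOrder lam S ι n S' ι') : IsShrunk lam S ι n S' ι' := by
  induction h with
  | one h => exact h.isShrunk
  | succ _ h' ih => exact ih.succ h'

/-- The factor 1 - λ in the tightness on the boundary cancels the geometric series 1 + λ + ⋯ +
λ^(n-1), uniformly in n. -/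
theorem IsShrunk.dist_le {n : ℕ} (h : IsShrunk lam S ι n S' ι') (h0 : 0 ≤ lam) (h1 : lam < 1)
    {r : ℝ} (hr : 0 ≤ r) {s : Finset E} (hs : s ∈ S.faces)
    (hdiam : Metric.ediam (ι '' (s : Set E)) ≤ ENNReal.ofReal ((1 - lam) * r)) {v w : E}
    (hv : v ∈ S'.vertices) (hvs : v ∈ convexHull ℝ (s : Set E)) (hw : w ∈ s) :
    dist (ι' v) (ι w) ≤ r := by
  have hsum : ∑ k ∈ Finset.range n, ENNReal.ofReal lam ^ k =
      ENNReal.ofReal (∑ k ∈ Finset.range n, lam ^ k) := by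
    rw [ENNReal.ofReal_sum_of_nonneg fun k _ => pow_nonneg h0 k]
    exact Finset.sum_congr rfl fun k _ => (ENNReal.ofReal_pow h0 k).symm
  have hgeom : (∑ k ∈ Finset.range n, lam ^ k) * (1 - lam) ≤ 1 := by
    rw [geom_sum_mul_neg]
    linarith [pow_nonneg h0 n]
  have hle := (h.edist_le s hs v hv hvs w hw).trans (mul_le_mul_right hdiam _)
  rw [hsum, ← ENNReal.ofReal_mul (Finset.sum_nonneg fun k _ => pow_nonneg h0 k), edist_dist,
    ENNReal.ofReal_le_ofReal_iff (mul_nonneg (Finset.sum_nonneg fun k _ => pow_nonneg h0 k)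
      (mul_nonneg (by linarith) hr)), ← mul_assoc] at hle
  exact hle.trans (mul_le_of_le_one_left hr hgeom)

end Subdivision

/-! ### Continuous weights and their passage to a subdivision -/

section Weights

variable {Z I : Type*} [TopologicalSpace Z]

/-- A locally finite continuous family of convex weights. -/
structure IsContinuousWeight (ρ : Z → I →₀ ℝ) : Prop where
  weight : ∀ z, IsConvexWeight (ρ z)
  continuous : ∀ i, Continuous fun z => ρ z i
  locallyFinite : ∀ z, ∃ F : Finset I, ∀ᶠ w in 𝓝 z, (ρ w).support ⊆ F

theorem exists_isContinuousWeight [NormalSpace Z] [ParacompactSpace Z] {U : I → Set Z}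
    (hU : ∀ i, IsOpen (U i)) (hcover : ∀ z, ∃ i, z ∈ U i) :
    ∃ ρ : Z → I →₀ ℝ, IsContinuousWeight ρ ∧ ∀ z, ∀ i ∈ (ρ z).support, z ∈ U i := by
  obtain ⟨f, hf⟩ := PartitionOfUnity.exists_isSubordinate isClosed_univ U hU
    fun z _ => mem_iUnion.2 (hcover z)
  have hfin : ∀ z, {i | f i z ≠ 0}.Finite := fun z => f.locallyFinite.point_finite z
  refine ⟨fun z => Finsupp.onFinset (hfin z).toFinset (fun i => f i z) fun i hi => by simpa using hi,
    ⟨fun z => ⟨fun i => f.nonneg i z, ?_⟩, fun i => (f i).continuous, fun z => ?_⟩,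
    fun z i hi => ?_⟩
  · refine Eq.trans ?_ (f.sum_eq_one (mem_univ z))
    rw [linearCombination_eq_sum_of_support_subset _ Finsupp.support_onFinset_subset,
      finsum_eq_sum_of_support_subset _ (s := (hfin z).toFinset) fun i hi => by simpa using hi]
    simp
  · obtain ⟨t, ht, hfin'⟩ := f.locallyFinite z
    refine ⟨hfin'.toFinset, mem_of_superset ht fun w hw i hi => ?_⟩
    rw [Set.Finite.mem_toFinset]
    exact ⟨w, by simpa using hi, hw⟩
  · exact hf i (subset_tsupport _ (by simpa using hi))

theorem continuousOn_biUnion_of_isClosed {Y J : Type*} [TopologicalSpace Y] {g : Z → Y}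
    {𝒜 : Set J} (h𝒜 : 𝒜.Finite) {A : J → Set Z} (hA : ∀ j ∈ 𝒜, IsClosed (A j))
    (hg : ∀ j ∈ 𝒜, ContinuousOn g (A j)) : ContinuousOn g (⋃ j ∈ 𝒜, A j) := by
  have := h𝒜.to_subtype
  rw [biUnion_eq_iUnion]
  exact (locallyFinite_of_finite _).continuousOn_iUnion (fun j => hA j j.2) fun j => hg j j.2

variable {ρ : Z → I →₀ ℝ}

/-- The simplex spanned by `s`, parametrized by barycentric coordinates. -/
def simplexParam (s : Finset (I →₀ ℝ)) (w : stdSimplex ℝ s) : I → ℝ := fun i => ∑ u : s, w.1 u * u.1 i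

theorem continuous_simplexParam (s : Finset (I →₀ ℝ)) : Continuous (simplexParam s) := by
  refine continuous_pi fun i => continuous_finsetSum _ fun u _ => ?_
  exact ((continuous_apply u).comp continuous_subtype_val).mul_const _

variable {S : Geometry.SimplicialComplex ℝ (I →₀ ℝ)}

theorem coe_combine_eq {s : Finset (I →₀ ℝ)} {w : (I →₀ ℝ) →₀ ℝ} (hs : w.support ⊆ s) (i : I) :
    combine w i = ∑ u : s, w u * u.1 i := by
  rw [combine, linearCombination_eq_sum_of_support_subset _ hs, Finsupp.finsetSum_apply,
    ← Finset.sum_coe_sort s]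
  rfl

theorem mem_stdSimplex_of_isConvexWeight {J : Type*} {s : Finset J} {w : J →₀ ℝ}
    (h : IsConvexWeight w) (hs : w.support ⊆ s) : (fun u : s => w u) ∈ stdSimplex ℝ s := by
  have := h.total
  rw [linearCombination_eq_sum_of_support_subset _ hs, ← Finset.sum_coe_sort s] at this
  exact ⟨fun u => h.nonneg u, by simpa using this⟩

theorem exists_isConvexWeight_of_mem_stdSimplex {J : Type*} {s : Finset J} {w : s → ℝ}
    (h : w ∈ stdSimplex ℝ s) :
    ∃ w' : J →₀ ℝ, IsConvexWeight w' ∧ w'.support ⊆ s ∧ ∀ u : s, w' u = w u := by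
  classical
  set w' : J →₀ ℝ := Finsupp.onFinset s (fun v => if hv : v ∈ s then w ⟨v, hv⟩ else 0)
    (fun v hv => by by_contra h; simp [h] at hv)
  have hw' : ∀ u : s, w' u = w u := fun u => by simp [w']
  have hs : w'.support ⊆ s := Finsupp.support_onFinset_subset
  refine ⟨w', ⟨fun v => ?_, ?_⟩, hs, hw'⟩
  · simp only [w', Finsupp.onFinset_apply]
    split_ifs
    exacts [h.1 _, le_rfl]
  · rw [linearCombination_eq_sum_of_support_subset _ hs, ← Finset.sum_coe_sort s]
    simpa [hw'] using h.2

theorem range_simplexParam (s : Finset (I →₀ ℝ)) :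
    range (simplexParam s) = (fun x : I →₀ ℝ => ⇑x) '' convexHull ℝ (s : Set (I →₀ ℝ)) := by
  ext f
  constructor
  · rintro ⟨⟨w, hw⟩, rfl⟩
    obtain ⟨w', hw', hs, e⟩ := exists_isConvexWeight_of_mem_stdSimplex hw
    refine ⟨combine w', mem_convexHull_finset_iff.2 ⟨w', hw', hs, rfl⟩, funext fun i => ?_⟩
    simp only [coe_combine_eq hs, e, simplexParam]
  · rintro ⟨x, hx, rfl⟩
    obtain ⟨w, hw, hs, rfl⟩ := mem_convexHull_finset_iff.1 hx
    exact ⟨⟨_, mem_stdSimplex_of_isConvexWeight hw hs⟩, funext fun i => (coe_combine_eq hs i).symm⟩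

theorem injective_simplexParam {s : Finset (I →₀ ℝ)} (hs : AffineIndependent ℝ ((↑) : s → I →₀ ℝ)) :
    Function.Injective (simplexParam s) := by
  rintro ⟨w₁, h₁⟩ ⟨w₂, h₂⟩ h
  obtain ⟨w₁', hw₁, hs₁, e₁⟩ := exists_isConvexWeight_of_mem_stdSimplex h₁
  obtain ⟨w₂', hw₂, hs₂, e₂⟩ := exists_isConvexWeight_of_mem_stdSimplex h₂
  have : w₁' = w₂' := eq_of_combine_eq hs hs₁ hs₂ (hw₁.total.trans hw₂.total.symm) <| by
    ext i
    have := congrFun h i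
    simpa only [coe_combine_eq hs₁, coe_combine_eq hs₂, e₁, e₂, simplexParam] using this
  refine Subtype.ext (funext fun u => ?_)
  exact (e₁ u).symm.trans ((congrArg (· u.1) this).trans (e₂ u))

/-- Continuity is coordinatewise, so the simplex is viewed in `I → ℝ`, where it is the compact image
of a standard simplex. -/
theorem isClosed_preimage_convexHull (hρ : ∀ i, Continuous fun z => ρ z i)
    (s : Finset (I →₀ ℝ)) : IsClosed {z | ρ z ∈ convexHull ℝ (s : Set (I →₀ ℝ))} := by
  have hc : IsClosed (range (simplexParam s)) :=
    (isCompact_range (continuous_simplexParam s)).isClosed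
  convert hc.preimage (continuous_pi hρ : Continuous fun z => ⇑(ρ z)) using 1
  ext z
  rw [range_simplexParam]
  exact (DFunLike.coe_injective.mem_set_image (f := fun x : I →₀ ℝ => ⇑x)).symm

/-- On one simplex the coordinates invert `simplexParam`, a closed embedding since it is injective
from a compact to a Hausdorff space. -/
theorem continuousOn_bary (hρ : ∀ i, Continuous fun z => ρ z i) {s : Finset (I →₀ ℝ)}
    (hs : s ∈ S.faces) (v : I →₀ ℝ) :
    ContinuousOn (fun z => bary S (ρ z) v) {z | ρ z ∈ convexHull ℝ (s : Set (I →₀ ℝ))} := by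
  set A := {z | ρ z ∈ convexHull ℝ (s : Set (I →₀ ℝ))}
  have hb : ∀ z : A, IsBary S (ρ z) (bary S (ρ z)) := fun z => isBary_bary_of_mem_convexHull hs z.2
  have hsupp : ∀ z : A, (bary S (ρ z)).support ⊆ s := fun z => support_bary_subset hs z.2
  have hemb := ((continuous_simplexParam s).isClosedEmbedding
    (injective_simplexParam (S.indep hs))).isInducing
  have hβ : Continuous fun z : A => (⟨fun u : s => bary S (ρ z) u,
      mem_stdSimplex_of_isConvexWeight (hb z).weight (hsupp z)⟩ : stdSimplex ℝ s) := by
    rw [hemb.continuous_iff]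
    have : Continuous fun z : A => ⇑(ρ z) := (continuous_pi hρ).comp continuous_subtype_val
    convert this using 1
    funext z i
    conv_rhs => rw [← (hb z).combine_eq, coe_combine_eq (hsupp z)]
    rfl
  rw [continuousOn_iff_continuous_domRestrict]
  by_cases hv : v ∈ s
  · exact (continuous_apply (⟨v, hv⟩ : s)).comp (continuous_subtype_val.comp hβ)
  · refine continuous_const (y := (0 : ℝ)) |>.congr fun z => ?_
    exact (Finsupp.notMem_support_iff.1 fun h => hv (hsupp z h)).symm

theorem mem_convexHull_of_eq_image_single {w : I →₀ ℝ} (hw : IsConvexWeight w)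
    {s : Finset (I →₀ ℝ)} (e : (s : Set (I →₀ ℝ)) = (Finsupp.single · 1) '' (w.support : Set I)) :
    w ∈ convexHull ℝ (s : Set (I →₀ ℝ)) := by
  have h := hw.combine_mem (convex_convexHull ℝ (s : Set (I →₀ ℝ)))
    (g := (Finsupp.single · 1)) fun i hi => subset_convexHull ℝ _ (e ▸ mem_image_of_mem _ hi)
  rw [Finsupp.linearCombination_apply] at h
  simpa using h

/-- Near z only finitely many simplices of S occur, each cut into finitely many simplices of S'.
Their preimages are closed, so continuity on each of them suffices. -/
theorem IsContinuousWeight.bary {S' : Geometry.SimplicialComplex ℝ (I →₀ ℝ)}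
    (hρ : IsContinuousWeight ρ) (hsub : IsLocallyFiniteSubdivision S S')
    (hface : ∀ z, ∃ s ∈ S.faces,
      (s : Set (I →₀ ℝ)) = (Finsupp.single · 1) '' ((ρ z).support : Set I)) :
    IsContinuousWeight fun z => bary S' (ρ z) := by
  classical
  have hspace : ∀ z, ρ z ∈ S'.space := fun z => by
    obtain ⟨s, hs, e⟩ := hface z
    exact hsub.space_eq ▸ S.mem_space_iff.2
      ⟨s, hs, mem_convexHull_of_eq_image_single (hρ.weight z) e⟩
  have hloc : ∀ z, ∃ 𝒜 : Set (Finset (I →₀ ℝ)), 𝒜.Finite ∧ 𝒜 ⊆ S'.faces ∧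
      ∀ᶠ w in 𝓝 z, (PushOff.bary S' (ρ w)).support ∈ 𝒜 := fun z => by
    obtain ⟨F, hF⟩ := hρ.locallyFinite z
    have hfin : {s ∈ S.faces | s ⊆ F.image (Finsupp.single · (1 : ℝ))}.Finite :=
      (F.image (Finsupp.single · (1 : ℝ))).powerset.finite_toSet.subset fun s hs =>
        Finset.mem_coe.2 (Finset.mem_powerset.2 hs.2)
    refine ⟨_, hfin.biUnion fun s hs => hsub.finite s hs.1, ?_, ?_⟩
    · exact iUnion₂_subset fun s _ => sep_subset _ _
    · filter_upwards [hF] with w hw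
      obtain ⟨s, hs, e⟩ := hface w
      refine mem_biUnion (x := s) ⟨hs, ?_⟩ ⟨support_bary_mem_faces (hspace w),
        hsub.support_bary_subset hs
          (mem_convexHull_of_eq_image_single (hρ.weight w) e)⟩
      rw [← Finset.coe_subset, e, Finset.coe_image]
      exact image_mono hw
  refine ⟨fun z => (isBary_bary (hspace z)).weight, fun v => ?_, fun z => ?_⟩
  · refine continuous_iff_continuousAt.2 fun z => ?_
    obtain ⟨𝒜, h𝒜, hsub𝒜, hev⟩ := hloc z
    refine (continuousOn_biUnion_of_isClosed h𝒜
      (fun s _ => isClosed_preimage_convexHull hρ.continuous s)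
      fun s hs => continuousOn_bary hρ.continuous (hsub𝒜 hs) v).continuousAt ?_
    filter_upwards [hev] with w hw
    exact mem_biUnion hw (mem_convexHull_support_bary (hspace w))
  · obtain ⟨𝒜, h𝒜, -, hev⟩ := hloc z
    refine ⟨h𝒜.toFinset.biUnion id, ?_⟩
    filter_upwards [hev] with w hw
    exact Finset.subset_biUnion_of_mem id (h𝒜.mem_toFinset.2 hw)

end Weights

/-! ### Iterated geodesic combinations -/

section Fold

variable {X I : Type*} [MetricSpace X]

/-- Moving a point of weight `a.2` towards a point `p` of weight `c`. -/
def weightedStep (a : X × ℝ) (c : ℝ) (p : X) : X × ℝ := (seg a.1 p (c / (a.2 + c)), a.2 + c)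

/-- The iterated weighted combination of the points `p i`, for `i` in a list, starting at `o`. -/
def weightedFold (o : X) (p : I → X) (w : I → ℝ) (l : List I) : X × ℝ :=
  l.foldl (fun a i => weightedStep a (w i) (p i)) (o, 0)

variable {o : X} {p : I → X} {w : I → ℝ}

theorem weightedFold_append_singleton (l : List I) (i : I) :
    weightedFold o p w (l ++ [i]) = weightedStep (weightedFold o p w l) (w i) (p i) := by
  simp [weightedFold]

theorem weightedStep_zero (hX : IsCAT0 X) (a : X × ℝ) (p : X) : weightedStep a 0 p = a := by
  rw [weightedStep, zero_div, seg_zero hX, add_zero]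

/-- A step of weight 0 does nothing. Hence one fixed list serves a whole neighbourhood although the
supports vary. -/
theorem weightedFold_filter (hX : IsCAT0 X) (l : List I) (P : I → Bool)
    (hP : ∀ i, P i = false → w i = 0) :
    weightedFold o p w (l.filter P) = weightedFold o p w l := by
  induction l using List.reverseRecOn with
  | nil => rfl
  | append_singleton l i ih =>
    rw [List.filter_append, weightedFold_append_singleton, ← ih]
    cases h : P i
    · rw [List.filter_singleton, h, hP i h, weightedStep_zero hX]
      simp
    · rw [List.filter_singleton, h, cond_true, weightedFold_append_singleton]

theorem weightedFold_snd (l : List I) : (weightedFold o p w l).2 = (l.map w).sum := by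
  induction l using List.reverseRecOn with
  | nil => rfl
  | append_singleton l i ih => simp [weightedFold_append_singleton, weightedStep, ih]

theorem weightedFold_snd_nonneg (hw : ∀ i, 0 ≤ w i) (l : List I) :
    0 ≤ (weightedFold o p w l).2 := by
  rw [weightedFold_snd]
  exact List.sum_nonneg (by simpa using fun i _ => hw i)

theorem div_add_mem_Icc {a b : ℝ} (ha : 0 ≤ a) (hb : 0 ≤ b) : b / (a + b) ∈ Icc (0 : ℝ) 1 :=
  ⟨by positivity, div_le_one_of_le₀ (by linarith) (by positivity)⟩

/-- The first nonzero weight has ratio 1 and erases the base point o; afterwards convexity of balls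
applies. -/
theorem dist_weightedFold_le (hX : IsCAT0 X) (hw : ∀ i, 0 ≤ w i) {c : X} {r : ℝ} (l : List I)
    (hl : ∀ i ∈ l, w i ≠ 0 → dist c (p i) ≤ r) (hpos : (weightedFold o p w l).2 ≠ 0) :
    dist c (weightedFold o p w l).1 ≤ r := by
  induction l using List.reverseRecOn with
  | nil => exact absurd rfl hpos
  | append_singleton l i ih =>
    rw [weightedFold_append_singleton] at hpos ⊢
    have ih' := ih fun j hj => hl j (by simp [hj])
    have h0 := weightedFold_snd_nonneg (o := o) (p := p) hw l
    by_cases hi : w i = 0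
    · rw [hi, weightedStep_zero hX] at hpos ⊢
      exact ih' hpos
    · have hp := hl i (by simp) hi
      by_cases hs : (weightedFold o p w l).2 = 0
      · rwa [weightedStep, hs, zero_add, div_self hi, seg_one hX]
      · exact dist_seg_le hX _ _ _ (div_add_mem_Icc h0 (hw i)) (ih' hs) hp

/-- A crude bound that also holds where the total weight vanishes, needed for continuity there. -/
theorem dist_weightedFold_le_of_forall (hX : IsCAT0 X) (hw : ∀ i, 0 ≤ w i) {c : X} {r : ℝ}
    (l : List I) (ho : dist c o ≤ r) (hl : ∀ i ∈ l, dist c (p i) ≤ r) :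
    dist c (weightedFold o p w l).1 ≤ r := by
  induction l using List.reverseRecOn with
  | nil => exact ho
  | append_singleton l i ih =>
    rw [weightedFold_append_singleton]
    exact dist_seg_le hX _ _ _ (div_add_mem_Icc (weightedFold_snd_nonneg hw l) (hw i))
      (ih fun j hj => hl j (by simp [hj])) (hl i (by simp))

theorem continuousAt_weightedFold (hX : IsCAT0 X) {Z : Type*} [TopologicalSpace Z]
    {ρ : Z → I → ℝ} (hρ : ∀ i, Continuous fun z => ρ z i) (h0 : ∀ z i, 0 ≤ ρ z i) (l : List I)
    {z : Z} (hz : (weightedFold o p (ρ z) l).2 ≠ 0) :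
    ContinuousAt (fun z => (weightedFold o p (ρ z) l).1) z := by
  induction l using List.reverseRecOn with
  | nil => exact absurd rfl hz
  | append_singleton l i ih =>
    simp only [weightedFold_append_singleton] at hz ⊢
    have hcs : Continuous fun z => (weightedFold o p (ρ z) l).2 := by
      simp only [weightedFold_snd]
      exact continuous_list_sum _ fun j _ => hρ j
    have ht : ContinuousAt (fun z => ρ z i / ((weightedFold o p (ρ z) l).2 + ρ z i)) z :=
      (hρ i).continuousAt.div (hcs.add (hρ i)).continuousAt hz
    have ht' : ∀ z, ρ z i / ((weightedFold o p (ρ z) l).2 + ρ z i) ∈ Icc (0 : ℝ) 1 := fun z =>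
      div_add_mem_Icc (weightedFold_snd_nonneg (h0 z) l) (h0 z i)
    by_cases hs : (weightedFold o p (ρ z) l).2 = 0
    -- Here the earlier fold may be discontinuous at z, but it stays bounded and the ratio tends to
    -- 1, so the new point tends to p i.
    · obtain ⟨R, hR⟩ : ∃ R, ∀ j ∈ l, dist (p i) (p j) ≤ R := by
        obtain ⟨R, hR⟩ := (l.finite_toSet.image fun j => dist (p i) (p j)).bddAbove
        exact ⟨R, fun j hj => hR (mem_image_of_mem _ hj)⟩
      have hb : ∀ z, dist (weightedFold o p (ρ z) l).1 (p i) ≤ max R (dist (p i) o) := fun z => by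
        rw [dist_comm]
        exact dist_weightedFold_le_of_forall hX (h0 z) l (le_max_right _ _)
          fun j hj => (hR j hj).trans (le_max_left _ _)
      have hz1 : ρ z i / ((weightedFold o p (ρ z) l).2 + ρ z i) = 1 := by
        rw [weightedStep] at hz
        dsimp only at hz
        rw [hs, zero_add] at hz ⊢
        exact div_self hz
      rw [ContinuousAt, weightedStep, hz1, seg_one hX, tendsto_iff_dist_tendsto_zero]
      refine squeeze_zero (fun _ => dist_nonneg) (fun y => ?_)
        (g := fun y => (1 - ρ y i / ((weightedFold o p (ρ y) l).2 + ρ y i)) *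
          max R (dist (p i) o)) ?_
      · rw [weightedStep, dist_seg_right hX _ _ (ht' y)]
        exact mul_le_mul_of_nonneg_left (hb y) (by linarith [(ht' y).2])
      · have := (ht.tendsto.const_sub 1).mul_const (max R (dist (p i) o))
        rwa [hz1, sub_self, zero_mul] at this
    · exact ContinuousAt.seg hX (ih hs) continuousAt_const ht ht'

/-- A locally finite family of weights on points of a `CAT(0)` space defines a continuous map. -/
theorem exists_continuous_of_isContinuousWeight (hX : IsCAT0 X) {Z : Type*} [TopologicalSpace Z]
    [Nonempty X] {ρ : Z → I →₀ ℝ} (hρ : IsContinuousWeight ρ) (p : I → X) :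
    ∃ f : Z → X, Continuous f ∧
      ∀ z c r, (∀ i ∈ (ρ z).support, dist c (p i) ≤ r) → dist c (f z) ≤ r := by
  classical
  -- The fold depends on the order of the points; a linear order on I fixes it for all z at once.
  obtain ⟨_, -⟩ := exists_wellFoundedLT I
  obtain ⟨o⟩ := ‹Nonempty X›
  have hsum : ∀ z (F : Finset I), (ρ z).support ⊆ F →
      (weightedFold o p (ρ z) F.sort).2 = 1 := fun z F hF => by
    have h := (hρ.weight z).total
    rw [linearCombination_eq_sum_of_support_subset _ hF] at h
    rw [weightedFold_snd, ← Multiset.sum_coe, ← Multiset.map_coe, Finset.sort_eq]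
    simpa using h
  refine ⟨fun z => (weightedFold o p (ρ z) (ρ z).support.sort).1, ?_, fun z c r h => ?_⟩
  · refine continuous_iff_continuousAt.2 fun z => ?_
    obtain ⟨F, hF⟩ := hρ.locallyFinite z
    refine (continuousAt_weightedFold (o := o) (p := p) hX (ρ := fun z => ⇑(ρ z)) hρ.continuous
      (fun z => (hρ.weight z).nonneg) F.sort ?_).congr ?_
    · rw [hsum z F hF.self_of_nhds]
      exact one_ne_zero
    · filter_upwards [hF] with w hw
      have e : (ρ w).support.sort = F.sort.filter fun i => ρ w i ≠ 0 := by
        have hn : (F.sort.filter fun i => ρ w i ≠ 0).Nodup := (F.sort_nodup _).filter _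
        rw [← (List.toFinset_sort (· ≤ ·) hn).2 ((F.pairwise_sort _).filter _)]
        congr 1
        ext i
        simpa using fun h => hw (Finsupp.mem_support_iff.2 h)
      rw [e, weightedFold_filter hX]
      simp
  · refine dist_weightedFold_le hX (hρ.weight z).nonneg _ (fun i hi _ => h i ?_) ?_
    · exact (Finset.mem_sort _).1 hi
    · rw [hsum z _ subset_rfl]
      exact one_ne_zero

end Fold

/-! ### Radial projection and the homotopy argument -/

section Retraction

variable {X : Type*} [MetricSpace X] {C : Set X} {ε : ℝ}

theorem mem_cthickening_iff_infDist_le (hne : C.Nonempty) (hε : 0 ≤ ε) {x : X} :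
    x ∈ Metric.cthickening ε C ↔ Metric.infDist x C ≤ ε := by
  rw [Metric.mem_cthickening_iff, Metric.infDist, ENNReal.le_ofReal_iff_toReal_le
    (Metric.infEDist_ne_top hne) hε]

theorem infDist_eq_of_mem_frontier (hne : C.Nonempty) (hε : 0 ≤ ε) {x : X}
    (hx : x ∈ frontier (Metric.cthickening ε C)) : Metric.infDist x C = ε := by
  have h1 : {x : X | Metric.infDist x C ≤ ε} = Metric.cthickening ε C := by
    ext x
    exact (mem_cthickening_iff_infDist_le hne hε).symm
  rw [← h1] at hx
  exact frontier_le_subset_eq (Metric.continuous_infDist_pt C) continuous_const hx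

/-- Radial projection onto the `ε`-neighbourhood of `C`. -/
def radial (C : Set X) (ε : ℝ) (x : X) : X :=
  seg (proj C x) x (ε / max ε (Metric.infDist x C))

theorem radial_param_mem (hε : 0 < ε) (x : X) :
    ε / max ε (Metric.infDist x C) ∈ Icc (0 : ℝ) 1 :=
  ⟨by positivity, div_le_one_of_le₀ (le_max_left _ _) (by positivity)⟩

theorem continuous_radial (hX : IsCAT0 X) (hC : IsProjectible C) (hε : 0 < ε) :
    Continuous (radial C ε) := by
  refine Continuous.seg hX (continuous_proj hX hC) continuous_id ?_ (radial_param_mem hε)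
  exact continuous_const.div (continuous_const.max (Metric.continuous_infDist_pt C))
    fun x => (lt_max_of_lt_left hε).ne'

theorem radial_eq_self (hX : IsCAT0 X) (hε : 0 < ε) {x : X} (hx : Metric.infDist x C ≤ ε) :
    radial C ε x = x := by
  rw [radial, max_eq_left hx, div_self hε.ne', seg_one hX]

/-- The point is only (1 - t)d(x,C) away from x, and the distance to C is 1-Lipschitz. -/
theorem le_infDist_seg_proj (hX : IsCAT0 X) (hC : IsProjectible C) (x : X) {t : ℝ}
    (ht : t ∈ Icc (0 : ℝ) 1) :
    t * Metric.infDist x C ≤ Metric.infDist (seg (proj C x) x t) C := by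
  have h1 := (proj_spec hX hC x).2
  have h2 := dist_seg_right hX (proj C x) x ht
  have h3 := Metric.infDist_le_infDist_add_dist (s := C) (x := x) (y := seg (proj C x) x t)
  rw [dist_comm x, h2, dist_comm, h1] at h3
  linarith

theorem radial_mem_frontier (hX : IsCAT0 X) (hC : IsProjectible C) (hε : 0 < ε) {x : X}
    (hx : ε < Metric.infDist x C) : radial C ε x ∈ frontier (Metric.cthickening ε C) := by
  set d := Metric.infDist x C with hd
  have hd0 : 0 < d := hε.trans hx
  have hr : radial C ε x = seg (proj C x) x (ε / d) := by
    rw [radial, ← hd, max_eq_right hx.le]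
  have ht : ε / d < 1 := (div_lt_one hd0).2 hx
  have ht' : ε / d ∈ Icc (0 : ℝ) 1 := ⟨by positivity, ht.le⟩
  rw [frontier_eq_closure_inter_closure]
  refine ⟨subset_closure ?_, ?_⟩
  · rw [mem_cthickening_iff_infDist_le hC.nonempty hε.le, hr]
    refine (Metric.infDist_le_dist_of_mem (proj_spec hX hC x).1).trans (le_of_eq ?_)
    rw [dist_comm, dist_left_seg hX _ _ ht', dist_comm, (proj_spec hX hC x).2, ← hd]
    field_simp
  -- Points slightly further along the segment have distance more than ε to C, so the radial image
  -- is a limit of points outside.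
  · have hlim : Tendsto (fun t : ℝ => seg (proj C x) x (projIcc (0 : ℝ) 1 zero_le_one t))
        (𝓝[>] (ε / d)) (𝓝 (radial C ε x)) := by
      have hc : Continuous fun t : ℝ => seg (proj C x) x (projIcc (0 : ℝ) 1 zero_le_one t) :=
        Continuous.seg hX continuous_const continuous_const
          (continuous_subtype_val.comp continuous_projIcc) fun t => (projIcc _ _ _ t).2
      have := (hc.tendsto (ε / d)).mono_left (nhdsWithin_le_nhds (s := Ioi (ε / d)))
      rwa [projIcc_of_mem _ ht', ← hr] at this
    refine mem_closure_of_tendsto hlim ?_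
    filter_upwards [Ioo_mem_nhdsGT ht] with t h
    have h' : t ∈ Icc (0 : ℝ) 1 := ⟨ht'.1.trans h.1.le, h.2.le⟩
    rw [projIcc_of_mem _ h', mem_compl_iff, mem_cthickening_iff_infDist_le hC.nonempty hε.le,
      not_le]
    exact ((div_lt_iff₀ hd0).1 h.1).trans_le (le_infDist_seg_proj hX hC x h')

theorem seg_mem_cthickening (hX : IsCAT0 X) (hC : IsProjectible C) (hε : 0 < ε) {x y : X}
    (hx : x ∈ Metric.cthickening ε C) (hy : y ∈ Metric.cthickening ε C) {t : ℝ}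
    (ht : t ∈ Icc (0 : ℝ) 1) : seg x y t ∈ Metric.cthickening ε C := by
  rw [mem_cthickening_iff_infDist_le hC.nonempty hε.le] at hx hy ⊢
  refine (infDist_seg_le hX hC x y ht).trans ?_
  nlinarith [ht.1, ht.2]

theorem contractibleSpace_cthickening (hX : IsCAT0 X) (hC : IsProjectible C) (hε : 0 < ε) :
    ContractibleSpace (Metric.cthickening ε C) := by
  obtain ⟨o, ho⟩ := hC.nonempty
  have ho' : o ∈ Metric.cthickening ε C := Metric.self_subset_cthickening C ho
  rw [contractible_iff_id_nullhomotopic]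
  refine ⟨⟨o, ho'⟩, ⟨?_⟩⟩
  refine ⟨⟨fun z => ⟨seg z.2.1 o z.1, seg_mem_cthickening hX hC hε z.2.2 ho' z.1.2⟩, ?_⟩,
    fun x => ?_, fun x => ?_⟩
  · refine Continuous.subtype_mk (Continuous.seg hX ?_ continuous_const ?_ fun z => z.1.2) _
    · fun_prop
    · fun_prop
  · simp [seg_zero hX]
  · simp [seg_one hX]

/-- A component of the frontier of the `ε`-neighbourhood of `C` is contractible if it can be pushed
off along geodesics by a map that is defined on the whole neighbourhood. -/
theorem contractibleSpace_of_pushOff (hX : IsCAT0 X) (hC : IsProjectible C) (hε : 0 < ε)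
    {B : Set X} (hB : IsComponentOf B (frontier (Metric.cthickening ε C)))
    {f : Metric.cthickening ε C → X} (hf : Continuous f)
    (hout : ∀ x, f x ∉ Metric.cthickening ε C)
    (hseg : ∀ q : Metric.cthickening ε C, (q : X) ∈ B → ∀ t ∈ Ioc (0 : ℝ) 1,
      ε < Metric.infDist (seg (q : X) (f q) t) C) : ContractibleSpace B := by
  obtain ⟨q₀, hq₀, rfl⟩ := hB
  set F := frontier (Metric.cthickening ε C)
  set B := connectedComponentIn F q₀
  have := contractibleSpace_cthickening hX hC hε
  have hBF : B ⊆ F := connectedComponentIn_subset F q₀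
  have hFC : F ⊆ Metric.cthickening ε C := Metric.isClosed_cthickening.frontier_subset
  have hrad : Continuous (radial C ε) := continuous_radial hX hC hε
  -- The path starts at q and stays in the frontier, so it remains in the component of q.
  have hpath : ∀ q (hq : q ∈ B), ∀ t ∈ Icc (0 : ℝ) 1,
      radial C ε (seg q (f ⟨q, hFC (hBF hq)⟩) t) ∈ B := fun q hq => by
    have hpre : IsPreconnected ((fun t => radial C ε (seg q (f ⟨q, hFC (hBF hq)⟩) t)) ''
        Icc (0 : ℝ) 1) := by
      refine isPreconnected_Icc.image _ (hrad.comp_continuousOn ?_)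
      rw [continuousOn_iff_continuous_domRestrict]
      exact Continuous.seg hX continuous_const continuous_const continuous_subtype_val
        fun t => t.2
    have hq' : radial C ε (seg q (f ⟨q, hFC (hBF hq)⟩) 0) = q := by
      rw [seg_zero hX, radial_eq_self hX hε (infDist_eq_of_mem_frontier hC.nonempty hε.le
        (hBF hq)).le]
    have hsub := hpre.subset_connectedComponentIn (F := F) (x := q) ⟨0, by simp, hq'⟩ ?_
    · rw [← connectedComponentIn_eq hq] at hsub
      exact fun t ht => hsub (mem_image_of_mem _ ht)
    · rintro _ ⟨t, ht, rfl⟩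
      rcases ht.1.eq_or_lt with rfl | h0
      · dsimp only
        rw [hq']
        exact hBF hq
      · exact radial_mem_frontier hX hC hε (hseg ⟨q, hFC (hBF hq)⟩ hq t ⟨h0, ht.2⟩)
  -- The image of the connected set C_ε lies in one component of the frontier, and the path from q₀
  -- shows that this component is B.
  have hg : ∀ x, radial C ε (f x) ∈ B := by
    have hmem := fun x => radial_mem_frontier hX hC hε (not_le.1 fun h => hout x
      ((mem_cthickening_iff_infDist_le hC.nonempty hε.le).2 h))
    have hq₀B : q₀ ∈ B := mem_connectedComponentIn hq₀
    have h1 := hpath q₀ hq₀B 1 ⟨zero_le_one, le_rfl⟩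
    rw [seg_one hX] at h1
    have hsub := (isPreconnected_range (hrad.comp hf)).subset_connectedComponentIn (F := F)
      (mem_range_self ⟨q₀, hFC hq₀⟩) (range_subset_iff.2 hmem)
    rw [Function.comp_apply, ← connectedComponentIn_eq h1] at hsub
    exact fun x => hsub (mem_range_self x)
  let g : C(Metric.cthickening ε C, B) :=
    ⟨fun x => ⟨radial C ε (f x), hg x⟩, (hrad.comp hf).subtype_mk _⟩
  let i : C(B, Metric.cthickening ε C) :=
    ⟨fun q => ⟨q, hFC (hBF q.2)⟩, continuous_subtype_val.subtype_mk _⟩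
  have hnull : (g.comp i).Nullhomotopic := by
    have h := (ContinuousMap.Nullhomotopic.comp_left
      ((contractible_iff_id_nullhomotopic _).1 this) i).comp_right g
    rwa [ContinuousMap.id_comp] at h
  have hhom : (ContinuousMap.id B).Homotopic (g.comp i) := by
    refine ⟨⟨⟨fun z => ⟨radial C ε (seg z.2.1 (f (i z.2)) z.1), hpath _ z.2.2 _ z.1.2⟩, ?_⟩,
      fun q => Subtype.ext ?_, fun q => Subtype.ext ?_⟩⟩
    · refine (hrad.comp (Continuous.seg hX ?_ (hf.comp (i.continuous.comp continuous_snd)) ?_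
        fun z => z.1.2)).subtype_mk _
      · fun_prop
      · fun_prop
    · simp [seg_zero hX, radial_eq_self hX hε (infDist_eq_of_mem_frontier hC.nonempty hε.le
        (hBF q.2)).le]
    · simp [seg_one hX, g, i]
  obtain ⟨y, hy⟩ := hnull
  exact (contractible_iff_id_nullhomotopic _).2 ⟨y, hhom.trans hy⟩

end Retraction

/-! ### Nerves and orbit families -/

section Nerve

variable {X : Type*}

theorem mem_nerve_faces {𝒱 : Set (Set X)} {s : Finset (Set X →₀ ℝ)} :
    s ∈ (nerve 𝒱).faces ↔ ∃ t : Finset (Set X), t.Nonempty ∧ (∀ U ∈ t, U ∈ 𝒱) ∧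
      (∃ x, ∀ U ∈ t, x ∈ U) ∧ (s : Set (Set X →₀ ℝ)) = vtx '' (t : Set (Set X)) := by
  classical
  constructor
  · rintro ⟨t, ⟨h1, h2, h3⟩, rfl⟩
    exact ⟨t, h1, h2, h3, Finset.coe_image⟩
  · rintro ⟨t, h1, h2, h3, e⟩
    refine ⟨t, ⟨h1, h2, h3⟩, Finset.coe_injective ?_⟩
    rw [e]
    exact Finset.coe_image

theorem nerve_faces_mono {𝒱 𝒲 : Set (Set X)} (h : 𝒱 ⊆ 𝒲) :
    (nerve 𝒱).faces ⊆ (nerve 𝒲).faces := fun s hs => by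
  obtain ⟨t, h1, h2, h3, e⟩ := mem_nerve_faces.1 hs
  exact mem_nerve_faces.2 ⟨t, h1, fun U hU => h (h2 U hU), h3, e⟩

theorem exists_eq_vtx_of_mem_vertices {𝒱 : Set (Set X)} {v : Set X →₀ ℝ}
    (hv : v ∈ (nerve 𝒱).vertices) : ∃ V ∈ 𝒱, v = vtx V := by
  obtain ⟨t, -, h2, -, e⟩ := mem_nerve_faces.1 hv
  have : v ∈ vtx '' (t : Set (Set X)) := e ▸ by simp
  obtain ⟨V, hV, rfl⟩ := this
  exact ⟨V, h2 V hV, rfl⟩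

theorem orbitFamily_mono {H : Type*} [Group H] [MulAction H X] {𝒰 𝒰' : Set (Set X)}
    (h : 𝒰 ⊆ 𝒰') : orbitFamily H 𝒰 ⊆ orbitFamily H 𝒰' := by
  rintro _ ⟨g, U, hU, rfl⟩
  exact ⟨g, U, h hU, rfl⟩

theorem mem_orbitFamily_self {H : Type*} [Group H] [MulAction H X] {𝒰 : Set (Set X)} {U : Set X}
    (h : U ∈ 𝒰) : U ∈ orbitFamily H 𝒰 :=
  ⟨1, U, h, (one_smul H U).symm⟩

end Nerve

theorem dist_le_of_mapDiam_le {E X : Type*} [AddCommGroup E] [Module ℝ E] [MetricSpace X]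
    {S : Geometry.SimplicialComplex ℝ E} {ι : E → X} {r : ℝ} (hr : 0 ≤ r)
    (h : mapDiam S ι ≤ ENNReal.ofReal r) {s : Finset E} (hs : s ∈ S.faces) {v w : E}
    (hv : v ∈ s) (hw : w ∈ s) : dist (ι v) (ι w) ≤ r := by
  have h1 : Metric.ediam (ι '' (s : Set E)) ≤ ENNReal.ofReal r :=
    (le_iSup₂ (f := fun (s : Finset E) (_ : s ∈ S.faces) => Metric.ediam (ι '' (s : Set E)))
      s hs).trans h
  have h2 := (Metric.edist_le_ediam_of_mem (mem_image_of_mem ι hv) (mem_image_of_mem ι hw)).trans h1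
  rwa [edist_dist, ENNReal.ofReal_le_ofReal_iff hr] at h2

theorem infDist_smul_of_smul_eq {H X : Type*} [MetricSpace X] [Group H] [MulAction H X]
    [IsIsometricSMul H X] {C : Set X} (hC : ∀ h : H, h • C = C) (h : H) (x : X) :
    Metric.infDist (h • x) C = Metric.infDist x C := by
  conv_lhs => rw [← hC h]
  rw [Metric.infDist, Metric.infDist, Metric.infEDist_smul]

/-! ### Construction of the push-off map -/

section PushOffMap

variable {X H : Type*} [MetricSpace X] [Group H] [MulAction H X] [IsIsometricSMul H X]

/-- The common core of (i) and (ii): `hout` keeps f outside C_ε, and `hbdry` ties κ to the grid ι,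
whose angles are known, over the boundary. -/
theorem contractibleSpace_of_isPushOffGrid (hX : IsCAT0 X) {C : Set X} (hC : IsProjectible C)
    (hCinv : ∀ h : H, h • C = C) {ε : ℝ} (hε : 0 < ε) {B : Set X}
    (hB : IsComponentOf B (frontier (Metric.cthickening ε C))) (hBinv : ∀ h : H, h • B = B)
    {Y K Kout : Set X} (hHK : orbitSet H K = Metric.cthickening ε C) {α : ℝ}
    (hα : Real.pi / 2 < α) {𝒰 : Set (Set X)} (hopen : ∀ U ∈ 𝒰, IsOpen U) (hcover : K ⊆ ⋃₀ 𝒰)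
    {δ δ' : ℝ} (hδ : 0 < δ) (hδ' : 0 < δ')
    (hsmall : IsSmall H C (Metric.cthickening ε C) B K Kout α δ δ')
    {ι : (Set X →₀ ℝ) → X} (hgrid : IsPushOffGrid H C B Y 𝒰 α ι)
    (hKout : ∀ U ∈ 𝒰, ι (vtx U) ∈ Kout)
    {S : Geometry.SimplicialComplex ℝ (Set X →₀ ℝ)} {κ : (Set X →₀ ℝ) → X}
    (hsub : IsLocallyFiniteSubdivision (nerve (orbitFamily H 𝒰)) S)
    (htight : IsTight H 𝒰 δ δ' S κ)
    (hout : ∀ v ∈ S.vertices, ∀ y, dist (κ v) y ≤ δ' → y ∉ Metric.cthickening ε C)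
    (hbdry : ∀ s ∈ (nerve (orbitFamily H (membersMeeting 𝒰 B))).faces, ∀ v ∈ S.vertices,
      v ∈ convexHull ℝ (s : Set (Set X →₀ ℝ)) → ∀ w ∈ s, dist (κ v) (ι w) ≤ δ') :
    ContractibleSpace B := by
  obtain ⟨o, ho⟩ := hC.nonempty
  have : Nonempty X := ⟨o⟩
  set Ce := Metric.cthickening ε C
  -- Only members meeting K are used, so that U lies in the δ-neighbourhood of K, where the angle
  -- condition is available.
  set 𝒱 := orbitFamily H {U ∈ 𝒰 | (U ∩ K).Nonempty}
  have h𝒱 : 𝒱 ⊆ orbitFamily H 𝒰 := orbitFamily_mono (sep_subset _ _)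
  obtain ⟨ρ, hρ, hρV⟩ := exists_isContinuousWeight (Z := Ce)
    (U := fun V : Set X => {z : Ce | (z : X) ∈ V ∧ V ∈ 𝒱})
    (fun V => by
      by_cases hV : V ∈ 𝒱
      · obtain ⟨h, U, hU, rfl⟩ := id hV
        simp only [hV, and_true]
        exact ((hopen U hU.1).smul h).preimage continuous_subtype_val
      · simp [hV])
    (fun z => by
      have hz : (z : X) ∈ orbitSet H K := hHK.symm.subset z.2
      obtain ⟨h, k, hk, e⟩ := mem_iUnion.1 hz
      obtain ⟨U, hU, hkU⟩ := hcover hk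
      exact ⟨h • U, ⟨k, hkU, e⟩, h, U, ⟨hU, k, hkU, hk⟩, rfl⟩)
  have hne : ∀ z, (ρ z).support.Nonempty := fun z => (hρ.weight z).support_nonempty
  have hface : ∀ z, ∃ s ∈ (nerve (orbitFamily H 𝒰)).faces,
      (s : Set (Set X →₀ ℝ)) = (Finsupp.single · 1) '' ((ρ z).support : Set (Set X)) := fun z => by
    classical
    refine ⟨(ρ z).support.image (Finsupp.single · 1), mem_nerve_faces.2 ⟨(ρ z).support, hne z,
      fun V hV => h𝒱 (hρV z V hV).2, ⟨z, fun V hV => (hρV z V hV).1⟩, Finset.coe_image⟩,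
      Finset.coe_image⟩
  have hmem : ∀ z, ∀ s : Finset (Set X →₀ ℝ),
      (s : Set (Set X →₀ ℝ)) = vtx '' ((ρ z).support : Set (Set X)) →
      ρ z ∈ convexHull ℝ (s : Set (Set X →₀ ℝ)) := fun z s e =>
    mem_convexHull_of_eq_image_single (hρ.weight z) e
  have hspace : ∀ z, ρ z ∈ S.space := fun z => by
    obtain ⟨s, hs, e⟩ := hface z
    rw [hsub.space_eq]
    exact Geometry.SimplicialComplex.mem_space_iff.2 ⟨s, hs, hmem z s e⟩
  obtain ⟨f, hf, hfball⟩ :=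
    exists_continuous_of_isContinuousWeight hX (hρ.bary hsub hface) κ
  have hvert : ∀ z, ∀ v ∈ (bary S (ρ z)).support, v ∈ S.vertices := fun z v hv => by
    rw [S.vertices_eq]
    exact mem_biUnion (support_bary_mem_faces (hspace z)) hv
  refine contractibleSpace_of_pushOff hX hC hε hB hf (fun z => ?_) fun q hq t ht => ?_
  · obtain ⟨v, hv⟩ := S.nonempty_of_mem_faces (support_bary_mem_faces (hspace z))
    exact hout v (hvert z v hv) _ (hfball z _ _ fun i hi =>
      dist_le_of_mapDiam_le hδ'.le htight.2 (support_bary_mem_faces (hspace z)) hv hi)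
  · obtain ⟨V, hV⟩ := hne q
    obtain ⟨hqV, h, U, ⟨hU, k, hkU, hkK⟩, rfl⟩ := hρV q V hV
    have hBmem : ∀ g : H, g⁻¹ • (q : X) ∈ B := fun g => by
      have := smul_mem_smul_set (a := g⁻¹) hq
      rwa [hBinv] at this
    have hqU : h⁻¹ • (q : X) ∈ U := mem_smul_set_iff_inv_smul_mem.1 hqV
    obtain ⟨s, hs, e⟩ := hface q
    -- Every set weighted at q contains q; translated back, it meets B because B is invariant.
    have hs' : s ∈ (nerve (orbitFamily H (membersMeeting 𝒰 B))).faces := by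
      refine mem_nerve_faces.2 ⟨(ρ q).support, hne q, fun W hW => ?_,
        ⟨q, fun W hW => (hρV q W hW).1⟩, e⟩
      obtain ⟨hqW, g, U', ⟨hU', -⟩, rfl⟩ := hρV q W hW
      exact ⟨g, U', ⟨hU', _, mem_smul_set_iff_inv_smul_mem.1 hqW, hBmem g⟩, rfl⟩
    have hVs : vtx (h • U) ∈ s := by
      rw [← Finset.mem_coe, e]
      exact mem_image_of_mem _ hV
    have hdist : dist (ι (vtx (h • U))) (f q) ≤ δ' := hfball q _ _ fun v hv => by
      rw [dist_comm]
      exact hbdry s hs' v (hvert q v hv) (hsub.support_bary_subset hs (hmem q s e)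
        (subset_convexHull ℝ _ hv)) _ hVs
    -- The points q and f(q) are both translated by h⁻¹, to the region near K and `Kout` where
    -- smallness is stated.
    rw [hgrid.equivariant h U (mem_orbitFamily_self hU), ← dist_smul h⁻¹, inv_smul_smul] at hdist
    obtain ⟨q₁, ⟨hq₁U, hq₁B⟩, hq₁⟩ := hgrid.angle_ge U ⟨hU, _, hqU, hBmem h⟩
    have hUdiam : ∀ x ∈ U, ∀ y ∈ U, dist x y ≤ δ := fun x hx y hy => by
      have := (Metric.edist_le_ediam_of_mem hx hy).trans (htight.1 U (mem_orbitFamily_self hU))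
      rwa [edist_dist, ENNReal.ofReal_le_ofReal_iff hδ.le] at this
    have hangle := hsmall.angle_close
      q₁ ⟨Metric.mem_cthickening_of_dist_le _ k _ _ hkK (hUdiam _ hq₁U _ hkU), hq₁B⟩
      (h⁻¹ • (q : X))
      ⟨Metric.mem_cthickening_of_dist_le _ k _ _ hkK (hUdiam _ hqU _ hkU), hBmem h⟩
      (ι (vtx U)) (Metric.self_subset_cthickening _ (hKout U hU))
      (h⁻¹ • f q) (Metric.mem_cthickening_of_dist_le _ _ _ _ (hKout U hU) (by rwa [dist_comm]))
      (hUdiam _ hq₁U _ hqU) hdist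
    have hfC : h⁻¹ • f q ∉ Ce := fun hmemC => by
      have : h⁻¹ • f q ∈ Metric.cthickening δ' Kout ∩ Ce :=
        ⟨Metric.mem_cthickening_of_dist_le _ _ _ _ (hKout U hU) (by rwa [dist_comm]), hmemC⟩
      rw [hsmall.disjoint] at this
      exact this
    have hqC : Metric.infDist (h⁻¹ • (q : X)) C = ε := by
      rw [infDist_smul_of_smul_eq hCinv]
      obtain ⟨x, -, rfl⟩ := hB
      exact infDist_eq_of_mem_frontier hC.nonempty hε.le (connectedComponentIn_subset _ _ hq)
    have hlt := infDist_lt_infDist_seg hX hC (q := h⁻¹ • (q : X)) (q' := h⁻¹ • f q)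
      (fun heq => hfC (by
        rw [← heq]
        exact (mem_cthickening_iff_infDist_le hC.nonempty hε.le).2 hqC.le))
      (by linarith [(abs_le.1 hangle).2]) (by rwa [hqC]) ht
    rwa [hqC, ← smul_seg hX _ _ _ ⟨ht.1.le, ht.2⟩, infDist_smul_of_smul_eq hCinv] at hlt

end PushOffMap

end PushOff

end

/-! ### The theorem -/

open PushOff
theorem mainTheorem2 {X H : Type*} [MetricSpace X] [Group H] [MulAction H X]
    [IsIsometricSMul H X]
    (hX : IsCAT0 X)
    (hproper : IsProperAction H X)
    (hfree : ∀ (h : H) (x : X), h • x = x → h = 1)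
    (C : Set X) (hCclosed : IsClosed C) (hCconvex : IsGeodConvex C)
    (hCinv : ∀ h : H, h • C = C)
    (hCcocompact : ∃ D : Set X, IsCompact D ∧ D ⊆ C ∧ orbitSet H D = C)
    (ε : ℝ) (hε : 0 < ε)
    (Sig : Set X) (hSig : IsComponentOf Sig (frontier (Metric.cthickening ε C)))
    (hSiginv : ∀ h : H, h • Sig = Sig)
    (Y : Set X) (hY : IsComponentOf Y (Metric.cthickening ε C)ᶜ)
    (hYSig : (frontier Y ∩ Sig).Nonempty)
    (K : Set X) (hK : IsCompact K) (hKsub : K ⊆ Metric.cthickening ε C)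
    (hHK : orbitSet H K = Metric.cthickening ε C)
    (Kout : Set X) (hKout : IsCompact Kout) (hKoutsub : Kout ⊆ Y)
    (α : ℝ) (hα : Real.pi / 2 < α)
    (𝒰 : Set (Set X)) (h𝒰fin : 𝒰.Finite) (h𝒰open : ∀ U ∈ 𝒰, IsOpen U) (h𝒰cover : K ⊆ ⋃₀ 𝒰)
    (δ δ' : ℝ) (hδ : 0 < δ) (hδ' : 0 < δ')
    (hsmall : IsSmall H C (Metric.cthickening ε C) Sig K Kout α δ δ') :
    ((∃ ι : (Set X →₀ ℝ) → X,
        IsPushOffGrid H C Sig Y 𝒰 α ι ∧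
        IsTight H 𝒰 δ δ' (nerve (orbitFamily H 𝒰)) ι ∧
        (∀ U ∈ 𝒰, ι (vtx U) ∈ Kout)) →
      ContractibleSpace Sig) ∧
    (∀ lam : ℝ, 1 / 2 ≤ lam → lam < 1 → ∀ n : ℕ,
      (∃ ι : (Set X →₀ ℝ) → X,
        IsPushOffGrid H C Sig Y 𝒰 α ι ∧
        IsTightOnBoundary H Sig 𝒰 δ ((1 - lam) * δ') ι ∧
        (∀ U ∈ 𝒰, ι (vtx U) ∈ Kout) ∧
        ∃ (Sn : Geometry.SimplicialComplex ℝ (Set X →₀ ℝ)) (ιn : (Set X →₀ ℝ) → X),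
          IsShrinkingSubdivisionOfOrder lam (nerve (orbitFamily H 𝒰)) ι n Sn ιn ∧
          IsTight H 𝒰 δ δ' Sn ιn ∧
          ENNReal.ofReal δ' < pushOffDist (Metric.cthickening ε C) Sn ιn) →
      ContractibleSpace Sig) := by
  -- C is nonempty because its ε-neighbourhood has a frontier point.
  have hC : IsProjectible C := by
    obtain ⟨D, hD, -, rfl⟩ := hCcocompact
    refine ⟨isComplete_orbitSet hproper hD, ?_, hCconvex⟩
    rw [nonempty_iff_ne_empty]
    intro h
    obtain ⟨x, hx, -⟩ := hSig
    simp [h] at hx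
  have hmono : (nerve (orbitFamily H (membersMeeting 𝒰 Sig))).faces ⊆
      (nerve (orbitFamily H 𝒰)).faces := nerve_faces_mono (orbitFamily_mono (sep_subset _ _))
  refine ⟨?_, fun lam hlam hlam' n => ?_⟩
  · rintro ⟨ι, hgrid, htight, hι⟩
    refine contractibleSpace_of_isPushOffGrid hX hC hCinv hε hSig hSiginv hHK hα h𝒰open h𝒰cover hδ
      hδ' hsmall hgrid hι (.refl _) htight (fun v hv y hy hyC => ?_) fun s hs v hv hvs w hw => ?_
    · obtain ⟨V, ⟨h, U, hU, rfl⟩, rfl⟩ := exists_eq_vtx_of_mem_vertices hv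
      rw [hgrid.equivariant h U (mem_orbitFamily_self hU), ← dist_smul h⁻¹, inv_smul_smul,
        dist_comm] at hy
      -- Only the points ι(U) with U in 𝒰 are known to lie in `Kout`; invariance of C_ε permits
      -- translating back to them.
      have : h⁻¹ • y ∈ Metric.cthickening δ' Kout ∩ Metric.cthickening ε C := by
        refine ⟨Metric.mem_cthickening_of_dist_le _ _ _ _ (hι U hU) hy, ?_⟩
        rwa [mem_cthickening_iff_infDist_le hC.nonempty hε.le, infDist_smul_of_smul_eq hCinv,
          ← mem_cthickening_iff_infDist_le hC.nonempty hε.le]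
      rw [hsmall.disjoint] at this
      exact this
    · exact dist_le_of_mapDiam_le hδ'.le htight.2 (hmono hs)
        ((Geometry.SimplicialComplex.vertex_mem_convexHull_iff hv (hmono hs)).1 hvs) hw
  · rintro ⟨ι, hgrid, hbdry, hι, Sn, ιn, hSn, htight, hpush⟩
    have hshrunk := hSn.isShrunk
    refine contractibleSpace_of_isPushOffGrid hX hC hCinv hε hSig hSiginv hHK hα h𝒰open h𝒰cover hδ
      hδ' hsmall hgrid hι hshrunk.subdivision htight (fun v hv y hy hyC => ?_)
      fun s hs v hv hvs w hw => ?_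
    · have h1 := hpush.trans_le ((iInf₂_le v hv).trans (Metric.infEDist_le_edist_of_mem hyC))
      rw [edist_dist] at h1
      exact h1.not_ge (ENNReal.ofReal_le_ofReal hy)
    · refine hshrunk.dist_le (by linarith) hlam' hδ'.le (hmono hs) ?_ hv hvs hw
      exact (le_iSup₂ (f := fun (s : Finset (Set X →₀ ℝ)) (_ : s ∈
        (nerve (orbitFamily H (membersMeeting 𝒰 Sig))).faces) =>
          Metric.ediam (ι '' (s : Set (Set X →₀ ℝ)))) s hs).trans hbdry.2
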